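/- For $n\ge 2$ write points of $\mathbb R^n$ as $x=(x',y)$ with $x'\in\mathbb R^{n-1}$, $y\in\mathbb R$. For $0<\gamma<1$ let $\phi(s)=s^\gamma$ if $s>0$ and $\phi(s)=0$ otherwise, and set $$\Omega_+=\{x\in(-1,1)^n: y>\phi(|x'|)\},\qquad \Omega_-=\{x\in(-1,1)^n: y<\phi(|x'|)\}.$$ For $\Omega\subset\mathbb R^n$ and $\eta>0$ let $\Omega^\eta=\{x\in\mathbb R^n:\operatorname{dist}(x,\Omega)<\eta\}$. For open $\Omega$ and $1\le p\le\infty$ let $L^p_{\mathrm{div}}(\Omega)=\{u\in L^p(\Omega;\mathbb R^n):\operatorname{div}u=0\text{ in }\mathcal D'(\Omega)\}$, with the $L^p$ norm. A bounded linear operator $\mathscr E:L^p_{\mathrm{div}}(\Omega)\to L^p_{\mathrm{div}}(\Omega')$, $\Omega\subset\Omega'$, is an extension operator if $\mathscr Eu=u$ a.e. in $\Omega$ for every $u$. For $\varepsilon>0$ and $0<\delta\le\infty$, an open set $\Omega$ is an $(\varepsilon,\delta)$-domain if any two distinct points $x,y\in\Omega$ with $|x-y|<\delta$ can be joined by a rectifiable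 curve $c$ in $\Omega$ of length less than $|x-y|/\varepsilon$ such that $\operatorname{dist}(z,\partial\Omega)\,|x-y|>\varepsilon\,|x-z|\,|y-z|$ for all $z$ on $c$. Then the following hold. (a) Let $n=2$. For every $0<\gamma<1$ there is $p\in[1,\infty)$ such that for every $\eta>0$ there is no bounded linear extension operator $L^p_{\mathrm{div}}(\Omega_+)\to L^p_{\mathrm{div}}(\Omega_+^\eta)$. (b) Let $n\ge2$. For every $0<\gamma<1$ there is $p\in(1,\infty)$ such that for every $\eta>0$ there is no bounded linear extension operator $L^p_{\mathrm{div}}(\Omega_-)\to L^p_{\mathrm{div}}(\Omega_-^\eta)$. (c) Let $n\ge3$. There are a bounded $(\varepsilon,\delta)$-domain $\Omega\subset\mathbb R^n$ (for some $\varepsilon>0$, $\delta\in(0,\infty]$), homeomorphic to the open unit ball, and $p\in(1,\infty)$ such that for every $\eta>0$ there is no bounded linear extension operator $L^p_{\mathrm{div}}(\Omega)\to L^p_{\mathrm{div}}(\Omega^\eta)$. -/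

import Mathlib

open MeasureTheory Set
open scoped ENNReal ContDiff

noncomputable section

/-- Euclidean space `ℝⁿ`, with the Euclidean norm. -/
abbrev Euc (n : ℕ) : Type := EuclideanSpace ℝ (Fin n)

/-! ### Solenoidal fields -/

/-- `div u = 0` in `𝒟'(Ω)`: `∫_Ω u · ∇φ = 0` for all `φ ∈ C_c^∞(Ω)`
(note that `fderiv ℝ φ x v = ∇φ(x) · v`). It is used only for `u ∈ L^p(Ω; ℝⁿ)` with `1 ≤ p`, for
which all these integrals converge, see `integrable_fderiv_apply`. -/
def DivFree {n : ℕ} (Ω : Set (Euc n)) (u : Euc n → Euc n) : Prop :=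
  ∀ φ : Euc n → ℝ, ContDiff ℝ ∞ φ → HasCompactSupport φ → tsupport φ ⊆ Ω →
    ∫ x in Ω, fderiv ℝ φ x (u x) = 0

theorem integrable_fderiv_apply {n : ℕ} {Ω : Set (Euc n)} {p : ℝ≥0∞} (hp : 1 ≤ p)
    {u : Euc n → Euc n} (hu : MemLp u p (volume.restrict Ω)) {φ : Euc n → ℝ}
    (hφ : ContDiff ℝ ∞ φ) (hc : HasCompactSupport φ) :
    Integrable (fun x => fderiv ℝ φ x (u x)) (volume.restrict Ω) := by
  have hcont : Continuous (fderiv ℝ φ) := hφ.continuous_fderiv (by simp)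
  have hcs : HasCompactSupport (fderiv ℝ φ) := hc.fderiv (𝕜 := ℝ)
  obtain ⟨C, hC⟩ := hcs.exists_bound_of_continuous hcont
  set K := tsupport (fderiv ℝ φ) with hK
  have hKc : IsCompact K := hcs
  have hu1 : IntegrableOn u K (volume.restrict Ω) :=
    (hu.locallyIntegrable hp).integrableOn_isCompact hKc
  have hmeas : AEStronglyMeasurable (fun x => fderiv ℝ φ x (u x)) (volume.restrict Ω) := by
    have h := isBoundedBilinearMap_apply (𝕜 := ℝ) (E := Euc n) (F := ℝ)
    exact h.continuous.comp_aestronglyMeasurable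
      (hcont.aestronglyMeasurable.prodMk hu.aestronglyMeasurable)
  have hon : IntegrableOn (fun x => fderiv ℝ φ x (u x)) K (volume.restrict Ω) := by
    refine Integrable.mono' (hu1.norm.const_mul C) hmeas.restrict ?_
    filter_upwards with x
    exact ((fderiv ℝ φ x).le_opNorm _).trans (by gcongr; exact hC x)
  refine (integrableOn_iff_integrable_of_support_subset ?_).1 hon
  intro x hx
  refine subset_tsupport _ ?_
  intro h0
  exact hx (by simp [h0])

/-- The space `L^p_div(Ω) = {u ∈ L^p(Ω; ℝⁿ) : div u = 0 in 𝒟'(Ω)}`, normed as a subspace of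
`L^p(Ω; ℝⁿ)`. -/
def LpDiv {n : ℕ} (p : ℝ≥0∞) [hp : Fact (1 ≤ p)] (Ω : Set (Euc n)) :
    Submodule ℝ (Lp (Euc n) p ((volume : Measure (Euc n)).restrict Ω)) where
  carrier := {u | DivFree Ω u}
  zero_mem' := by
    intro φ _ _ _
    rw [integral_eq_zero_of_ae]
    filter_upwards [Lp.coeFn_zero (Euc n) p ((volume : Measure (Euc n)).restrict Ω)] with x hx
    rw [hx]
    simp
  add_mem' := by
    intro u v hu hv φ h1 h2 h3
    have hu' := integrable_fderiv_apply hp.out (Lp.memLp u) h1 h2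
    have hv' := integrable_fderiv_apply hp.out (Lp.memLp v) h1 h2
    have h := integral_add hu' hv'
    rw [hu φ h1 h2 h3, hv φ h1 h2 h3, add_zero] at h
    rw [← h]
    refine integral_congr_ae ?_
    filter_upwards [Lp.coeFn_add u v] with x hx
    rw [hx]
    simp
  smul_mem' := by
    intro c u hu φ h1 h2 h3
    have h := integral_const_mul (μ := (volume : Measure (Euc n)).restrict Ω) c
      (fun x => fderiv ℝ φ x (u x))
    rw [hu φ h1 h2 h3, mul_zero] at h
    rw [← h]
    refine integral_congr_ae ?_
    filter_upwards [Lp.coeFn_smul c u] with x hx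
    rw [hx]
    simp

/-- There is a bounded linear operator `E : L^p_div(Ω) → L^p_div(Ω')` with `E u = u` a.e. in `Ω`
for all `u` (meant for `Ω ⊆ Ω'`). -/
def HasSolenoidalExtension {n : ℕ} (p : ℝ≥0∞) [Fact (1 ≤ p)] (Ω Ω' : Set (Euc n)) : Prop :=
  ∃ E : LpDiv p Ω →L[ℝ] LpDiv p Ω', ∀ u : LpDiv p Ω,
    ((E u : Lp (Euc n) p (volume.restrict Ω')) : Euc n → Euc n)
      =ᵐ[volume.restrict Ω] ((u : Lp (Euc n) p (volume.restrict Ω)) : Euc n → Euc n)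

/-! ### The cuspidal domains -/

/-- The profile `s ↦ s^γ` for `s > 0`, and `0` otherwise. -/
def cuspProfile (γ s : ℝ) : ℝ := if 0 < s then s ^ γ else 0

/-- The first `m` coordinates `x'` of `x = (x', y) ∈ ℝ^m × ℝ = ℝ^{m+1}`. -/
def horizontal {m : ℕ} (x : Euc (m + 1)) : Euc m := WithLp.toLp 2 fun i => x i.castSucc

/-- `Ω₊ = {(x', y) ∈ (-1,1)^n : y > φ(|x'|)}`, `n = m + 1`, with an outward cusp at `0`. -/
def outwardCusp (m : ℕ) (γ : ℝ) : Set (Euc (m + 1)) :=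
  {x | (∀ i, x i ∈ Ioo (-1 : ℝ) 1) ∧ x (Fin.last m) > cuspProfile γ ‖horizontal x‖}

/-- `Ω₋ = {(x', y) ∈ (-1,1)^n : y < φ(|x'|)}`, `n = m + 1`, with an inward cusp at `0`. -/
def inwardCusp (m : ℕ) (γ : ℝ) : Set (Euc (m + 1)) :=
  {x | (∀ i, x i ∈ Ioo (-1 : ℝ) 1) ∧ x (Fin.last m) < cuspProfile γ ‖horizontal x‖}

/-! ### `(ε, δ)`-domains -/

/-- `(ε, δ)`-domains, `ε > 0`, `0 < δ ≤ ∞`: any two distinct points `x, y ∈ Ω` with `|x - y| < δ`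
are joined by a curve `c` in `Ω` of length `< |x - y| / ε` (the length is the total variation, so
`c` is rectifiable) with `dist(z, ∂Ω) |x - y| > ε |x - z| |y - z|` for all `z` on `c`.
Distances to `∂Ω` are extended, so that the distance to the empty set is `∞`. -/
def IsEpsDeltaDomain {n : ℕ} (ε : ℝ) (δ : ℝ≥0∞) (Ω : Set (Euc n)) : Prop :=
  0 < ε ∧ 0 < δ ∧ IsOpen Ω ∧
    ∀ x ∈ Ω, ∀ y ∈ Ω, x ≠ y → edist x y < δ →
      ∃ c : Path x y, (∀ t, c t ∈ Ω) ∧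
        eVariationOn c univ < ENNReal.ofReal (dist x y / ε) ∧
        ∀ t, ENNReal.ofReal (ε * (dist x (c t) * dist y (c t))) <
          Metric.infEDist (c t) (frontier Ω) * edist x y

end

/-!
Both obstructions come from a divergence-free field on `Ω` whose flux an extension would have to
absorb in the complement of `Ω` near a boundary point. Test functions `φ_s` concentrated at scale
`s` detect a fixed amount of flux of the field over `Ω`, whereas by Hölder's inequality the
contribution of an extension `v ∈ L^p` over `B(0, s) \ Ω` is at most
`s⁻¹ ‖v‖_p |B(0, s) \ Ω|^(1 - 1/p)`, which tends to `0` if the complement is thin enough.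

At an inward cusp the field is the point source `x / |x|ⁿ`, which is in `L^p` for `p < n / (n - 1)`,
while the complement is thin because `γ < 1`. At an outward cusp in the plane it is the shear flow
`(1 / y, 0)`, and `φ_s` rises from `0` to `1` inside the cusp at height `s`, so that the flux
through the sections at height `s` has to return outside; here any `p > 2` makes even whole
balls thin enough, and the field is in `L^p` for `p < 1 + 1 / γ`.

For `γ = 1/2` and `n ≥ 3` the complement of the inward cusp near `0` is the spike `|x'| ≤ y²`,
`y ≥ 0`. Two points can be joined around it, by rotating `x'` along a great circle of the sphere in
`ℝ^(n-1)`, which is connected, and moving `|x'|` away from `0` on the way.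
-/

open Filter Metric
open scoped NNReal Topology RealInnerProductSpace

/-! ### Integration by parts and solenoidal fields -/

theorem integrable_of_continuousOn_of_support_subset {X F : Type*} [TopologicalSpace X] [T2Space X]
    [MeasurableSpace X] [OpensMeasurableSpace X] {μ : Measure X} [IsFiniteMeasureOnCompacts μ]
    [NormedAddCommGroup F] {U K : Set X} (hU : IsOpen U) (hK : IsCompact K) (hKU : K ⊆ U)
    {f : X → F} (hf : ContinuousOn f U) (hfK : Function.support f ⊆ K) : Integrable f μ := by
  have htsupp : tsupport f ⊆ K := closure_minimal hfK hK.isClosed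
  have hcont : Continuous f := continuous_of_tsupport fun x hx =>
    hf.continuousAt (hU.mem_nhds (hKU (htsupp hx)))
  exact hcont.integrable_of_hasCompactSupport (hK.of_isClosed_subset (isClosed_tsupport f) htsupp)

theorem integral_mul_fderiv_eq_neg_of_tsupport_subset {E : Type*} [NormedAddCommGroup E]
    [NormedSpace ℝ E] [FiniteDimensional ℝ E] [MeasurableSpace E] [BorelSpace E]
    {μ : Measure E} [μ.IsAddHaarMeasure] {U : Set E} (hU : IsOpen U) {f φ : E → ℝ}
    (hf : ContDiffOn ℝ 1 f U) (hφ : ContDiff ℝ 1 φ) (hc : HasCompactSupport φ)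
    (hs : tsupport φ ⊆ U) (v : E) :
    ∫ x, f x * fderiv ℝ φ x v ∂μ = -∫ x, fderiv ℝ f x v * φ x ∂μ := by
  have integrable_mul {g h : E → ℝ} (hg : ContinuousOn g U) (hh : Continuous h)
      (hsupp : Function.support h ⊆ tsupport φ) : Integrable (fun x => g x * h x) μ :=
    integrable_of_continuousOn_of_support_subset hU hc.isCompact hs (hg.mul hh.continuousOn)
      ((Function.support_mul_subset_right _ _).trans hsupp)
  have hderiv : Continuous fun x => fderiv ℝ φ x v :=
    (hφ.continuous_fderiv one_ne_zero).clm_apply continuous_const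
  refine integral_mul_fderiv_eq_neg_fderiv_mul_of_integrable
    (integrable_mul ((hf.continuousOn_fderiv_of_isOpen hU le_rfl).clm_apply continuousOn_const)
      hφ.continuous (subset_tsupport φ))
    (integrable_mul hf.continuousOn hderiv fun x hx => tsupport_fderiv_subset ℝ <|
      subset_tsupport _ fun h => hx (by simp [h]))
    (integrable_mul hf.continuousOn hφ.continuous (subset_tsupport φ))
    (fun x hx => (hf.contDiffAt (hU.mem_nhds (hs hx))).differentiableAt one_ne_zero)
    fun x _ => hφ.differentiable one_ne_zero x

theorem fderiv_eq_zero_of_notMem_tsupport {E : Type*} [NormedAddCommGroup E]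
    [NormedSpace ℝ E] {φ : E → ℝ} {x : E} (hx : x ∉ tsupport φ) : fderiv ℝ φ x = 0 :=
  image_eq_zero_of_notMem_tsupport fun h => hx (tsupport_fderiv_subset ℝ h)

section Solenoidal

variable {n : ℕ} {U Ω : Set (Euc n)} {u v : Euc n → Euc n}

theorem setIntegral_fderiv_apply_of_tsupport_subset {φ : Euc n → ℝ} (hs : tsupport φ ⊆ U) :
    ∫ x in U, fderiv ℝ φ x (u x) = ∫ x, fderiv ℝ φ x (u x) :=
  setIntegral_eq_integral_of_forall_compl_eq_zero fun x hx => by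
    rw [fderiv_eq_zero_of_notMem_tsupport fun h => hx (hs h), zero_apply]

theorem divFree_smul_const (hU : IsOpen U) {f : Euc n → ℝ} (hf : ContDiffOn ℝ 1 f U) {e : Euc n}
    (he : ∀ x ∈ U, fderiv ℝ f x e = 0) : DivFree U fun x => f x • e := by
  intro φ hφ hc hs
  have hzero : ∀ x, fderiv ℝ f x e * φ x = 0 := fun x => by
    by_cases hx : x ∈ tsupport φ
    · rw [he x (hs hx), zero_mul]
    · rw [image_eq_zero_of_notMem_tsupport hx, mul_zero]
  rw [setIntegral_fderiv_apply_of_tsupport_subset hs]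
  simp only [map_smul, smul_eq_mul]
  rw [integral_mul_fderiv_eq_neg_of_tsupport_subset hU hf (hφ.of_le (by simp)) hc hs]
  simp only [hzero, integral_zero, neg_zero]

theorem DivFree.congr_ae (hu : DivFree U u) (h : v =ᵐ[volume.restrict U] u) : DivFree U v := by
  intro φ hφ hc hs
  rw [← hu φ hφ hc hs]
  refine integral_congr_ae ?_
  filter_upwards [h] with x hx
  rw [hx]

/-- Some field in `L^p_div(Ω)` has no extension in `L^p_div(Ω^η)`, whatever `η > 0`. This rules out
every extension map, be it linear or not. -/
def HasNonextendableField (p : ℝ≥0∞) (Ω : Set (Euc n)) : Prop :=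
  ∃ u : Euc n → Euc n, MemLp u p (volume.restrict Ω) ∧ DivFree Ω u ∧
    ∀ η : ℝ, 0 < η → ∀ v : Euc n → Euc n, MemLp v p (volume.restrict (thickening η Ω)) →
      DivFree (thickening η Ω) v → ¬ v =ᵐ[volume.restrict Ω] u

theorem HasNonextendableField.not_hasSolenoidalExtension {p : ℝ≥0∞} [Fact (1 ≤ p)]
    (h : HasNonextendableField p Ω) {η : ℝ} (hη : 0 < η) :
    ¬ HasSolenoidalExtension p Ω (thickening η Ω) := by
  rintro ⟨E, hE⟩
  obtain ⟨u, hu, hdiv, hne⟩ := h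
  let u' : LpDiv p Ω := ⟨hu.toLp u, hdiv.congr_ae hu.coeFn_toLp⟩
  exact hne η hη _ (Lp.memLp (E u' : Lp (Euc n) p (volume.restrict (thickening η Ω)))) (E u').2
    ((hE u').trans hu.coeFn_toLp)

end Solenoidal

/-! ### Thin complements cannot absorb flux -/

section Holder

variable {α F G : Type*} [MeasurableSpace α] {μ : Measure α} [NormedAddCommGroup F]
  [NormedAddCommGroup G] [NormedSpace ℝ G] {p : ℝ≥0∞}

theorem one_sub_one_div_toReal_nonneg (hp : 1 ≤ p) : 0 ≤ 1 - 1 / p.toReal := by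
  rcases eq_or_ne p ⊤ with rfl | hpt
  · simp
  · rw [sub_nonneg]
    exact div_le_one_of_le₀ (by simpa using ENNReal.toReal_mono hpt hp) ENNReal.toReal_nonneg

theorem setIntegral_norm_le_eLpNorm_mul_measureReal_rpow (hp : 1 ≤ p) {w : α → F}
    (hw : MemLp w p μ) {s : Set α} (hs : μ s ≠ ⊤) :
    ∫ x in s, ‖w x‖ ∂μ ≤ (eLpNorm w p μ).toReal * μ.real s ^ (1 - 1 / p.toReal) := by
  have holder := eLpNorm_le_eLpNorm_mul_rpow_measure_univ (μ := μ.restrict s) hp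
    hw.aestronglyMeasurable.restrict
  rw [integral_norm_eq_lintegral_enorm hw.aestronglyMeasurable.restrict,
    ← eLpNorm_one_eq_lintegral_enorm, Measure.real, ENNReal.toReal_rpow, ← ENNReal.toReal_mul]
  refine ENNReal.toReal_mono (ENNReal.mul_ne_top hw.eLpNorm_ne_top
    (ENNReal.rpow_ne_top_of_nonneg (one_sub_one_div_toReal_nonneg hp) hs)) (holder.trans ?_)
  rw [Measure.restrict_apply_univ, ENNReal.toReal_one, div_one]
  gcongr
  exact Measure.restrict_le_self

theorem norm_integral_le_mul_eLpNorm_mul_measureReal_rpow (hp : 1 ≤ p) {w : α → F}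
    (hw : MemLp w p μ) {s : Set α} (hs : MeasurableSet s) (hμs : μ s ≠ ⊤) {M : ℝ} (hM : 0 ≤ M)
    {f : α → G} (hf : ∀ᵐ x ∂μ, ‖f x‖ ≤ s.indicator (fun x => M * ‖w x‖) x) :
    ‖∫ x, f x ∂μ‖ ≤ M * ((eLpNorm w p μ).toReal * μ.real s ^ (1 - 1 / p.toReal)) := by
  have : Fact (μ s < ⊤) := ⟨hμs.lt_top⟩
  calc ‖∫ x, f x ∂μ‖ ≤ ∫ x, s.indicator (fun x => M * ‖w x‖) x ∂μ :=
        norm_integral_le_of_norm_le ((integrable_indicator_iff hs).2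
          (((hw.restrict s).integrable hp).norm.const_mul M)) hf
    _ = M * ∫ x in s, ‖w x‖ ∂μ := by rw [integral_indicator hs, integral_const_mul]
    _ ≤ _ := by gcongr; exact setIntegral_norm_le_eLpNorm_mul_measureReal_rpow hp hw hμs

end Holder

section Dilation

variable {E : Type*} [NormedAddCommGroup E] [NormedSpace ℝ E] {χ : E → ℝ} {s : ℝ}

/-- The dilation `x ↦ χ (x / s)` of a test function, which concentrates it at the origin as
`s → 0`. -/
noncomputable def dilate (s : ℝ) (χ : E → ℝ) (x : E) : ℝ := χ (s⁻¹ • x)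

theorem contDiff_dilate (hχ : ContDiff ℝ ∞ χ) (s : ℝ) : ContDiff ℝ ∞ (dilate s χ) :=
  hχ.comp (contDiff_const_smul s⁻¹)

theorem hasCompactSupport_dilate (hχ : HasCompactSupport χ) (hs : s ≠ 0) :
    HasCompactSupport (dilate s χ) :=
  hχ.comp_smul (inv_ne_zero hs)

theorem tsupport_dilate_subset {R : ℝ} (hR : tsupport χ ⊆ ball 0 R) (hs : 0 < s) :
    tsupport (dilate s χ) ⊆ ball 0 (R * s) := by
  intro x hx
  have := hR (tsupport_comp_subset_preimage χ (continuous_const_smul s⁻¹) hx)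
  rwa [mem_ball_zero_iff, norm_smul, norm_inv, Real.norm_of_nonneg hs.le, inv_mul_lt_iff₀ hs,
    mul_comm, ← mem_ball_zero_iff] at this

theorem norm_fderiv_dilate_le {C : ℝ} (hC : ∀ x, ‖fderiv ℝ χ x‖ ≤ C) (hs : 0 ≤ s) (x : E) :
    ‖fderiv ℝ (dilate s χ) x‖ ≤ s⁻¹ * C := by
  have : fderiv ℝ (dilate s χ) x = s⁻¹ • fderiv ℝ χ (s⁻¹ • x) := fderiv_comp_smul s⁻¹
  rw [this, norm_smul, norm_inv, Real.norm_of_nonneg hs]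
  gcongr
  exact hC _

end Dilation

theorem ball_subset_thickening_of_mem_closure {X : Type*} [PseudoMetricSpace X] {s : Set X}
    {x : X} (hx : x ∈ closure s) (η : ℝ) : ball x η ⊆ thickening η s := by
  rw [← thickening_closure, thickening_eq_biUnion_ball]
  exact subset_biUnion_of_mem (u := fun x => ball x η) hx

section Obstruction

variable {n : ℕ} {p : ℝ≥0∞} {Ω Ω' : Set (Euc n)} {g v w : Euc n → Euc n} {R C s : ℝ}

/-- Test functions which live at distance at most comparable to `s` from the origin and vary at
scale `s` outside `Ω`; inside `Ω`, where the field is prescribed, they may vary faster. -/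
structure IsTestFunctionAtScale (Ω : Set (Euc n)) (R C s : ℝ) (φ : Euc n → ℝ) : Prop where
  contDiff : ContDiff ℝ ∞ φ
  hasCompactSupport : HasCompactSupport φ
  tsupport_subset : tsupport φ ⊆ ball 0 (R * s)
  norm_fderiv_le : ∀ x ∉ Ω, ‖fderiv ℝ φ x‖ ≤ s⁻¹ * C

theorem isTestFunctionAtScale_dilate {χ : Euc n → ℝ} (hχ : ContDiff ℝ ∞ χ)
    (hχc : HasCompactSupport χ) (hR : tsupport χ ⊆ ball 0 R) (hC : ∀ x, ‖fderiv ℝ χ x‖ ≤ C)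
    (hs : 0 < s) : IsTestFunctionAtScale Ω R C s (dilate s χ) where
  contDiff := contDiff_dilate hχ s
  hasCompactSupport := hasCompactSupport_dilate hχc hs.ne'
  tsupport_subset := tsupport_dilate_subset hR hs
  norm_fderiv_le x _ := norm_fderiv_dilate_le hC hs.le x

theorem IsTestFunctionAtScale.norm_setIntegral_fderiv_le {φ : Euc n → ℝ}
    (hφ : IsTestFunctionAtScale Ω R C s φ) (hp : 1 ≤ p) (hΩ : MeasurableSet Ω)
    (hw : MemLp w p (volume.restrict Ω')) (hwΩ : ∀ᵐ x, x ∈ Ω → w x = 0) (hC : 0 ≤ C)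
    (hs : 0 < s) : ‖∫ x in Ω', fderiv ℝ φ x (w x)‖ ≤ s⁻¹ * C *
      ((eLpNorm w p (volume.restrict Ω')).toReal *
        volume.real (ball 0 (R * s) \ Ω) ^ (1 - 1 / p.toReal)) := by
  set E : Set (Euc n) := ball 0 (R * s) \ Ω
  have hEfin : volume E ≠ ⊤ := ((measure_mono sdiff_subset).trans_lt measure_ball_lt_top).ne
  have hEΩ' : volume.restrict Ω' E ≤ volume E := Measure.restrict_apply_le _ _
  have pointwise : ∀ᵐ x ∂volume.restrict Ω', ‖fderiv ℝ φ x (w x)‖ ≤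
      E.indicator (fun x => s⁻¹ * C * ‖w x‖) x := by
    filter_upwards [ae_restrict_of_ae hwΩ] with x hx
    by_cases hxE : x ∈ E
    · rw [indicator_of_mem hxE]
      exact (fderiv ℝ φ x).le_of_opNorm_le (hφ.norm_fderiv_le x hxE.2) _
    · rw [indicator_of_notMem hxE]
      by_cases hxΩ : x ∈ Ω
      · rw [hx hxΩ, map_zero, norm_zero]
      · rw [fderiv_eq_zero_of_notMem_tsupport fun h => hxE ⟨hφ.tsupport_subset h, hxΩ⟩,
          zero_apply, norm_zero]
  refine (norm_integral_le_mul_eLpNorm_mul_measureReal_rpow hp hw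
    (measurableSet_ball.diff hΩ) (ne_top_of_le_ne_top hEfin hEΩ') (by positivity)
    pointwise).trans ?_
  have := one_sub_one_div_toReal_nonneg hp
  gcongr
  exact ENNReal.toReal_mono hEfin hEΩ'

theorem eq_zero_of_flux_eq_of_thin_compl (hp : 1 ≤ p) (hΩ : MeasurableSet Ω) (h0 : Ω' ∈ 𝓝 0)
    (hg : MemLp g p (volume.restrict Ω')) (hv : MemLp v p (volume.restrict Ω'))
    (hvdiv : DivFree Ω' v) (hvg : v =ᵐ[volume.restrict Ω] g) {φ : ℝ → Euc n → ℝ} {c : ℝ}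
    (hφ : ∀ᶠ s in 𝓝[>] 0, IsTestFunctionAtScale Ω R C s (φ s)) (hC : 0 ≤ C)
    (hflux : ∀ᶠ s in 𝓝[>] 0, ∫ x, fderiv ℝ (φ s) x (g x) = c)
    (hthin : Tendsto (fun s => s⁻¹ * volume.real (ball 0 (R * s) \ Ω) ^ (1 - 1 / p.toReal))
      (𝓝[>] 0) (𝓝 0)) : c = 0 := by
  obtain ⟨η, hη, hηΩ'⟩ := Metric.mem_nhds_iff.1 h0
  have hw : ∀ᵐ x, x ∈ Ω → (v - g) x = 0 := by
    rw [← ae_restrict_iff' hΩ]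
    filter_upwards [hvg] with x hx
    rw [Pi.sub_apply, hx, sub_self]
  have small : ∀ᶠ s in 𝓝[>] (0 : ℝ), R * s < η :=
    (Continuous.tendsto' (by fun_prop) 0 0 (mul_zero R) |>.mono_left
      nhdsWithin_le_nhds).eventually_lt_const hη
  have bound : ∀ᶠ s in 𝓝[>] 0, ‖c‖ ≤ C * (eLpNorm (v - g) p (volume.restrict Ω')).toReal *
      (s⁻¹ * volume.real (ball 0 (R * s) \ Ω) ^ (1 - 1 / p.toReal)) := by
    filter_upwards [self_mem_nhdsWithin, small, hφ, hflux] with s (hs : 0 < s) hsη hφ hflux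
    have hsupp : tsupport (φ s) ⊆ Ω' :=
      hφ.tsupport_subset.trans ((ball_subset_ball hsη.le).trans hηΩ')
    have flux_sub : ∫ x in Ω', fderiv ℝ (φ s) x ((v - g) x) = -c := by
      simp only [Pi.sub_apply, map_sub]
      rw [integral_sub (integrable_fderiv_apply hp hv hφ.contDiff hφ.hasCompactSupport)
        (integrable_fderiv_apply hp hg hφ.contDiff hφ.hasCompactSupport),
        hvdiv _ hφ.contDiff hφ.hasCompactSupport hsupp,
        setIntegral_fderiv_apply_of_tsupport_subset hsupp, hflux, zero_sub]
    have := hφ.norm_setIntegral_fderiv_le hp hΩ (hv.sub hg) hw hC hs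
    rw [flux_sub, norm_neg] at this
    exact this.trans_eq (by ring)
  have := ge_of_tendsto (hthin.const_mul _) bound
  rwa [mul_zero, norm_le_zero_iff] at this

/-- If the complement of `Ω` is too thin at `0 ∈ ∂Ω`, it cannot balance the flux `c` that `g`
carries in `Ω` arbitrarily close to `0`. -/
theorem hasNonextendableField_of_thin_compl (hp : 1 ≤ p) (hΩ : MeasurableSet Ω)
    (h0 : 0 ∈ closure Ω) (hg : ∀ η : ℝ, 0 < η → MemLp g p (volume.restrict (thickening η Ω)))
    (hgdiv : DivFree Ω g) {φ : ℝ → Euc n → ℝ} {c : ℝ}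
    (hφ : ∀ᶠ s in 𝓝[>] 0, IsTestFunctionAtScale Ω R C s (φ s)) (hC : 0 ≤ C)
    (hflux : ∀ᶠ s in 𝓝[>] 0, ∫ x, fderiv ℝ (φ s) x (g x) = c) (hc : c ≠ 0)
    (hthin : Tendsto (fun s => s⁻¹ * volume.real (ball 0 (R * s) \ Ω) ^ (1 - 1 / p.toReal))
      (𝓝[>] 0) (𝓝 0)) : HasNonextendableField p Ω := by
  refine ⟨g, (hg 1 one_pos).mono_measure
    (Measure.restrict_mono (self_subset_thickening one_pos Ω) le_rfl), hgdiv, ?_⟩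
  intro η hη v hv hvdiv hvg
  have hnhds : thickening η Ω ∈ 𝓝 0 :=
    mem_of_superset (ball_mem_nhds 0 hη) (ball_subset_thickening_of_mem_closure h0 η)
  exact hc (eq_zero_of_flux_eq_of_thin_compl hp hΩ hnhds (hg η hη) hv hvdiv hvg hφ hC hflux hthin)

end Obstruction

theorem exists_norm_fderiv_le_of_hasCompactSupport {E F : Type*} [NormedAddCommGroup E]
    [NormedSpace ℝ E] [NormedAddCommGroup F] [NormedSpace ℝ F] {f : E → F} (hf : ContDiff ℝ 1 f)
    (hc : HasCompactSupport f) : ∃ C, 0 ≤ C ∧ ∀ x, ‖fderiv ℝ f x‖ ≤ C := by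
  obtain ⟨C, hC⟩ := (hc.fderiv (𝕜 := ℝ)).exists_bound_of_continuous
    (hf.continuous_fderiv one_ne_zero)
  exact ⟨C, (norm_nonneg _).trans (hC 0), hC⟩

theorem tendsto_inv_mul_rpow_of_le {f : ℝ → ℝ} {K a q : ℝ} (hf : ∀ᶠ s in 𝓝[>] 0, 0 ≤ f s)
    (hfK : ∀ᶠ s in 𝓝[>] 0, f s ≤ K * s ^ a) (hq : 0 ≤ q) (haq : 1 < a * q) :
    Tendsto (fun s => s⁻¹ * f s ^ q) (𝓝[>] 0) (𝓝 0) := by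
  have hlim : Tendsto (fun s : ℝ => |K| ^ q * s ^ (a * q - 1)) (𝓝[>] 0) (𝓝 0) := by
    have := (Real.continuousAt_rpow_const 0 (a * q - 1) (.inr (by linarith))).const_mul (|K| ^ q)
    simpa [ContinuousAt, Real.zero_rpow (by linarith : a * q - 1 ≠ 0)] using
      this.mono_left nhdsWithin_le_nhds
  refine squeeze_zero' ?_ ?_ hlim
  · filter_upwards [self_mem_nhdsWithin, hf] with s (hs : 0 < s) hfs
    positivity
  · filter_upwards [self_mem_nhdsWithin, hf, hfK] with s (hs : 0 < s) hfs hfsK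
    calc s⁻¹ * f s ^ q ≤ s⁻¹ * (|K| * s ^ a) ^ q := by
          gcongr
          exact hfsK.trans (by gcongr; exact le_abs_self K)
      _ = |K| ^ q * s ^ (a * q - 1) := by
          rw [Real.mul_rpow (abs_nonneg K) (by positivity), ← Real.rpow_mul hs.le,
            Real.rpow_sub_one hs.ne']
          ring

/-! ### Point sources -/

/-- The field `x / |x|ᵈ` of a point source at the origin of a `d`-dimensional space. -/
noncomputable def pointSource {E : Type*} [NormedAddCommGroup E] [NormedSpace ℝ E] (x : E) : E :=
  (‖x‖ ^ Module.finrank ℝ E)⁻¹ • x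

theorem norm_pointSource_le {E : Type*} [NormedAddCommGroup E] [NormedSpace ℝ E] (x : E) :
    ‖pointSource x‖ ≤ ‖x‖ ^ (-((Module.finrank ℝ E : ℝ) - 1)) := by
  rcases eq_or_ne x 0 with rfl | hx
  · simpa [pointSource] using Real.rpow_nonneg le_rfl _
  · rw [pointSource, norm_smul, norm_inv, norm_pow, norm_norm, neg_sub, sub_eq_add_neg,
      Real.rpow_add (norm_pos_iff.2 hx), Real.rpow_one, Real.rpow_neg (norm_nonneg x),
      Real.rpow_natCast, mul_comm]

theorem measurable_pointSource {E : Type*} [NormedAddCommGroup E] [NormedSpace ℝ E]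
    [FiniteDimensional ℝ E] [MeasurableSpace E] [BorelSpace E] :
    Measurable (pointSource (E := E)) := by
  unfold pointSource
  fun_prop

theorem integral_Ioi_fderiv_smul {E : Type*} [NormedAddCommGroup E] [NormedSpace ℝ E] {φ : E → ℝ}
    (hφ : ContDiff ℝ 1 φ) (hc : HasCompactSupport φ) {x : E} (hx : x ≠ 0) :
    ∫ r in Ioi (0 : ℝ), fderiv ℝ φ (r • x) x = -φ 0 := by
  have hderiv (r : ℝ) : deriv (fun r : ℝ => φ (r • x)) r = fderiv ℝ φ (r • x) x := by
    have := (hφ.differentiable one_ne_zero (r • x)).hasFDerivAt.comp_hasDerivAt r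
      ((hasDerivAt_id r).smul_const x)
    simpa [Function.comp_def] using this.deriv
  have hcomp : HasCompactSupport fun r : ℝ => φ (r • x) :=
    hc.comp_isClosedEmbedding (isClosedEmbedding_smul_left hx)
  have := hcomp.integral_Ioi_deriv_eq (by fun_prop) 0
  simpa only [hderiv, zero_smul] using this

section PointSource

variable {E : Type*} [NormedAddCommGroup E] [NormedSpace ℝ E] [FiniteDimensional ℝ E]
  [Nontrivial E] [MeasurableSpace E] [BorelSpace E] (μ : Measure E) [μ.IsAddHaarMeasure]

theorem integral_eq_integral_toSphere_integral_Ioi {F : Type*} [NormedAddCommGroup F]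
    [NormedSpace ℝ F] {f : E → F} (hf : Integrable f μ) :
    ∫ x, f x ∂μ = ∫ θ : sphere (0 : E) 1, (∫ r in Ioi (0 : ℝ),
      r ^ (Module.finrank ℝ E - 1) • f (r • (θ : E))) ∂μ.toSphere := by
  have polar := μ.measurePreserving_homeomorphUnitSphereProd
  let G : sphere (0 : E) 1 × Ioi (0 : ℝ) → F := fun z => f ((z.2 : ℝ) • (z.1 : E))
  have hG (x : ({0}ᶜ : Set E)) : G (homeomorphUnitSphereProd E x) = f x := by
    simp [G, smul_smul, mul_inv_cancel₀ (norm_ne_zero_iff.2 x.2)]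
  have hGint : Integrable G (μ.toSphere.prod (.volumeIoiPow (Module.finrank ℝ E - 1))) := by
    rw [← polar.integrable_comp_emb (Homeomorph.measurableEmbedding _)]
    have : G ∘ homeomorphUnitSphereProd E = f ∘ (↑) := funext hG
    rwa [this, ← integrableOn_iff_comap_subtypeVal (measurableSet_singleton 0).compl,
      IntegrableOn, restrict_compl_singleton]
  have radial (θ : sphere (0 : E) 1) :
      ∫ r, G (θ, r) ∂.volumeIoiPow (Module.finrank ℝ E - 1) =
        ∫ r in Ioi (0 : ℝ), r ^ (Module.finrank ℝ E - 1) • f (r • (θ : E)) := by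
    simp only [Measure.volumeIoiPow, ENNReal.ofReal]
    rw [integral_withDensity_eq_integral_smul
        (measurable_subtype_coe.pow_const _).real_toNNReal,
      integral_subtype_comap measurableSet_Ioi fun r =>
        Real.toNNReal (r ^ (Module.finrank ℝ E - 1)) • f (r • (θ : E))]
    refine setIntegral_congr_fun measurableSet_Ioi fun r (hr : 0 < r) => ?_
    rw [NNReal.smul_def, Real.coe_toNNReal _ (pow_nonneg hr.le _)]
  calc ∫ x, f x ∂μ = ∫ x : ({0}ᶜ : Set E), f x ∂μ.comap (↑) := by
        rw [integral_subtype_comap (measurableSet_singleton _).compl, restrict_compl_singleton]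
    _ = ∫ z, G z ∂μ.toSphere.prod (.volumeIoiPow (Module.finrank ℝ E - 1)) := by
        rw [← polar.integral_comp (Homeomorph.measurableEmbedding _)]
        simp only [hG]
    _ = _ := by rw [integral_prod _ hGint]; simp only [radial]

theorem memLp_pointSource {p : ℝ} (hp : 0 < p)
    (hpd : p * (Module.finrank ℝ E - 1) < Module.finrank ℝ E) (R : ℝ) :
    MemLp pointSource (ENNReal.ofReal p) (μ.restrict (ball (0 : E) R)) := by
  rw [← integrable_norm_rpow_iff measurable_pointSource.aestronglyMeasurable
    (by simpa using hp) ENNReal.ofReal_ne_top, ENNReal.toReal_ofReal hp.le]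
  refine integrableOn_ball_of_norm_le_rpow (C := 1) Module.finrank_pos hpd (.of_forall fun x => ?_)
    (measurable_pointSource.norm.pow_const p).aestronglyMeasurable
  rw [Real.norm_of_nonneg (by positivity), one_mul, mul_comm, ← neg_mul,
    Real.rpow_mul (norm_nonneg x)]
  gcongr
  exact norm_pointSource_le x

variable {φ : E → ℝ}

theorem integrable_fderiv_pointSource (hφ : ContDiff ℝ 1 φ) (hc : HasCompactSupport φ) :
    Integrable (fun x => fderiv ℝ φ x (pointSource x)) μ := by
  have hloc : LocallyIntegrable (pointSource (E := E)) μ :=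
    locallyIntegrable_of_norm_le_rpow (C := 1) Module.finrank_pos (sub_one_lt _)
      (.of_forall fun x => by simpa using norm_pointSource_le x)
      measurable_pointSource.aestronglyMeasurable
  have hcont := hφ.continuous_fderiv one_ne_zero
  refine ((hloc.integrable_smul_left_of_hasCompactSupport hcont.norm
    (hc.fderiv (𝕜 := ℝ)).norm).norm).mono' ?_ (.of_forall fun x => ?_)
  · exact (isBoundedBilinearMap_apply (𝕜 := ℝ)).continuous.comp_aestronglyMeasurable
      (hcont.aestronglyMeasurable.prodMk measurable_pointSource.aestronglyMeasurable)
  · rw [norm_smul, norm_norm]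
    exact (fderiv ℝ φ x).le_opNorm _

/-- The distributional divergence of the point source is a multiple of the Dirac mass at `0`. -/
theorem integral_fderiv_pointSource (hφ : ContDiff ℝ 1 φ) (hc : HasCompactSupport φ) :
    ∫ x, fderiv ℝ φ x (pointSource x) ∂μ = -(μ.toSphere.real univ * φ 0) := by
  have radial (θ : sphere (0 : E) 1) : ∫ r in Ioi (0 : ℝ), r ^ (Module.finrank ℝ E - 1) •
      fderiv ℝ φ (r • (θ : E)) (pointSource (r • (θ : E))) = -φ 0 := by
    rw [← integral_Ioi_fderiv_smul hφ hc (ne_zero_of_mem_unit_sphere θ)]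
    refine setIntegral_congr_fun measurableSet_Ioi fun r (hr : 0 < r) => ?_
    have hpow : r ^ Module.finrank ℝ E = r ^ (Module.finrank ℝ E - 1) * r :=
      (pow_sub_one_mul Module.finrank_pos.ne' r).symm
    simp only [pointSource, norm_smul, Real.norm_of_nonneg hr.le, norm_eq_of_mem_sphere, mul_one,
      map_smul, smul_eq_mul, hpow]
    field_simp
  rw [integral_eq_integral_toSphere_integral_Ioi μ (integrable_fderiv_pointSource μ hφ hc)]
  simp_rw [radial]
  rw [integral_const, smul_eq_mul, mul_neg]

end PointSource

theorem divFree_pointSource {n : ℕ} [NeZero n] {Ω : Set (Euc n)} (h0 : 0 ∉ Ω) :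
    DivFree Ω pointSource := by
  intro φ hφ hc hs
  rw [setIntegral_fderiv_apply_of_tsupport_subset hs,
    integral_fderiv_pointSource volume (hφ.of_le (by simp)) hc,
    image_eq_zero_of_notMem_tsupport fun h => h0 (hs h), mul_zero, neg_zero]

theorem hasNonextendableField_pointSource {n : ℕ} [NeZero n] {p : ℝ} (hp : 1 ≤ p)
    (hpn : p * (n - 1) < n) {Ω : Set (Euc n)} (hΩ : MeasurableSet Ω)
    (hb : Bornology.IsBounded Ω) (h0 : 0 ∉ Ω) (h0c : 0 ∈ closure Ω)
    (hthin : Tendsto (fun s => s⁻¹ * volume.real (ball 0 s \ Ω) ^ (1 - 1 / p))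
      (𝓝[>] 0) (𝓝 0)) :
    HasNonextendableField (ENNReal.ofReal p) Ω := by
  let χ : ContDiffBump (0 : Euc n) := ⟨1 / 4, 1 / 2, by norm_num, by norm_num⟩
  have hχ0 : χ 0 = 1 := χ.one_of_mem_closedBall (mem_closedBall_self χ.rIn_pos.le)
  have hR : tsupport χ ⊆ ball 0 1 :=
    χ.tsupport_eq.trans_subset (closedBall_subset_ball (by norm_num [χ]))
  have hflux : ∀ᶠ s in 𝓝[>] 0, ∫ x, fderiv ℝ (dilate s χ) x (pointSource x) =
      -(volume : Measure (Euc n)).toSphere.real univ := by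
    filter_upwards [self_mem_nhdsWithin] with s (hs : 0 < s)
    rw [integral_fderiv_pointSource volume ((contDiff_dilate χ.contDiff s).of_le (by simp))
      (hasCompactSupport_dilate χ.hasCompactSupport hs.ne'), dilate, smul_zero, hχ0, mul_one]
  have hsphere : (volume : Measure (Euc n)).toSphere.real univ ≠ 0 := by
    rw [measureReal_ne_zero_iff, Measure.measure_univ_ne_zero]
    exact Measure.toSphere_ne_zero _
  obtain ⟨C, hC0, hC⟩ := exists_norm_fderiv_le_of_hasCompactSupport χ.contDiff χ.hasCompactSupport
  have htest : ∀ᶠ s in 𝓝[>] 0, IsTestFunctionAtScale Ω 1 C s (dilate s χ) := by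
    filter_upwards [self_mem_nhdsWithin] with s hs
    exact isTestFunctionAtScale_dilate χ.contDiff χ.hasCompactSupport hR hC hs
  refine hasNonextendableField_of_thin_compl (by simpa using hp) hΩ h0c (fun η _ => ?_)
    (divFree_pointSource h0) htest hC0 hflux (neg_ne_zero.2 hsphere)
    (by simpa [ENNReal.toReal_ofReal (zero_le_one.trans hp)] using hthin)
  obtain ⟨R, hR⟩ := (hb.thickening (δ := η)).subset_ball 0
  exact (memLp_pointSource volume (by linarith) (by simpa using hpn) R).mono_measure
    (Measure.restrict_mono hR le_rfl)

/-! ### Inward cusps -/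

section CuspProfile

variable {γ s : ℝ}

theorem cuspProfile_eq_max_rpow (hγ : 0 < γ) (s : ℝ) : cuspProfile γ s = max s 0 ^ γ := by
  unfold cuspProfile
  split_ifs with h
  · rw [max_eq_left h.le]
  · rw [max_eq_right (not_lt.1 h), Real.zero_rpow hγ.ne']

theorem continuous_cuspProfile (hγ : 0 < γ) : Continuous (cuspProfile γ) := by
  rw [funext (cuspProfile_eq_max_rpow hγ)]
  exact (continuous_id.max continuous_const).rpow_const fun _ => .inr hγ.le

theorem cuspProfile_of_nonneg (hγ : 0 < γ) (hs : 0 ≤ s) : cuspProfile γ s = s ^ γ := by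
  rw [cuspProfile_eq_max_rpow hγ, max_eq_left hs]

end CuspProfile

section CuspGeometry

variable {m : ℕ} {γ : ℝ}

theorem continuous_horizontal : Continuous (horizontal (m := m)) := by
  unfold horizontal
  fun_prop

theorem horizontal_smul (c : ℝ) (x : Euc (m + 1)) : horizontal (c • x) = c • horizontal x := rfl

theorem horizontal_single_last (t : ℝ) :
    horizontal (EuclideanSpace.single (Fin.last m) t) = 0 := by
  ext i
  simp [horizontal]

theorem abs_le_norm_horizontal (x : Euc (m + 1)) (i : Fin m) :
    |x i.castSucc| ≤ ‖horizontal x‖ :=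
  PiLp.norm_apply_le (horizontal x) i

theorem isOpen_forall_mem_Ioo (n : ℕ) : IsOpen {x : Euc n | ∀ i, x i ∈ Ioo (-1 : ℝ) 1} := by
  simp only [ofPred_forall]
  exact isOpen_iInter_of_finite fun i => isOpen_Ioo.preimage (EuclideanSpace.proj i).continuous

theorem isBounded_setOf_forall_mem_Icc {ι : Type*} [Finite ι] (a b : ι → ℝ) :
    Bornology.IsBounded {x : EuclideanSpace ℝ ι | ∀ i, x i ∈ Icc (a i) (b i)} := by
  have := Fintype.ofFinite ι
  exact ((PiLp.antilipschitzWith_ofLp 2 fun _ : ι => ℝ).isBounded_preimage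
    (isBounded_Icc a b)).subset fun _ hx => ⟨fun i => (hx i).1, fun i => (hx i).2⟩

theorem isBounded_forall_mem_Ioo (n : ℕ) :
    Bornology.IsBounded {x : Euc n | ∀ i, x i ∈ Ioo (-1 : ℝ) 1} :=
  (isBounded_setOf_forall_mem_Icc (-1) 1).subset fun _ hx i => Ioo_subset_Icc_self (hx i)

theorem isOpen_inwardCusp (hγ : 0 < γ) : IsOpen (inwardCusp m γ) :=
  (isOpen_forall_mem_Ioo (m + 1)).inter (isOpen_lt (EuclideanSpace.proj _).continuous
    ((continuous_cuspProfile hγ).comp continuous_horizontal.norm))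

theorem isOpen_outwardCusp (hγ : 0 < γ) : IsOpen (outwardCusp m γ) :=
  (isOpen_forall_mem_Ioo (m + 1)).inter
    (isOpen_lt ((continuous_cuspProfile hγ).comp continuous_horizontal.norm)
      (EuclideanSpace.proj _).continuous)

theorem isBounded_inwardCusp : Bornology.IsBounded (inwardCusp m γ) :=
  (isBounded_forall_mem_Ioo (m + 1)).subset fun _ hx => hx.1

theorem zero_notMem_inwardCusp : 0 ∉ inwardCusp m γ := by
  rintro ⟨-, h⟩
  rw [show horizontal (0 : Euc (m + 1)) = 0 from rfl, norm_zero, cuspProfile, if_neg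
    (lt_irrefl 0)] at h
  exact lt_irrefl _ h

theorem tendsto_smul_nhdsGT_zero {E : Type*} [AddCommMonoid E] [TopologicalSpace E] [Module ℝ E]
    [ContinuousSMul ℝ E] (x : E) : Tendsto (fun t : ℝ => t • x) (𝓝[>] 0) (𝓝 0) :=
  (Continuous.tendsto' (by fun_prop) 0 0 (zero_smul ℝ x)).mono_left nhdsWithin_le_nhds

theorem zero_mem_closure_inwardCusp : 0 ∈ closure (inwardCusp m γ) := by
  refine mem_closure_of_tendsto
    (tendsto_smul_nhdsGT_zero (EuclideanSpace.single (Fin.last m) (-1))) ?_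
  filter_upwards [Ioo_mem_nhdsGT one_pos] with t ⟨ht0, ht1⟩
  refine ⟨Fin.forall_fin_succ'.2 ⟨fun j => ?_, ?_⟩, ?_⟩
  · simp [(Fin.castSucc_lt_last j).ne]
  · have : -t < 1 := by linarith
    simpa [ht1] using this
  · simpa [horizontal_smul, horizontal_single_last, cuspProfile] using ht0

theorem volume_real_setOf_abs_castSucc_le_abs_last_le {a b : ℝ} (ha : 0 ≤ a) (hb : 0 ≤ b) :
    volume.real {x : Euc (m + 1) | (∀ i : Fin m, |x i.castSucc| ≤ a) ∧ |x (Fin.last m)| ≤ b} =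
      (2 * a) ^ m * (2 * b) := by
  set c : Fin (m + 1) → ℝ := Fin.snoc (fun _ => a) b with hc
  have box : {x : Euc (m + 1) | (∀ i : Fin m, |x i.castSucc| ≤ a) ∧ |x (Fin.last m)| ≤ b} =
      WithLp.ofLp ⁻¹' (Icc (-c) c) := by
    ext x
    simp only [mem_ofPred_eq, mem_preimage, mem_Icc, Pi.le_def, Fin.forall_fin_succ', Pi.neg_apply,
      hc, Fin.snoc_castSucc, Fin.snoc_last, abs_le]
    grind
  have hle : -c ≤ c := fun i => by
    refine Fin.lastCases ?_ (fun j => ?_) i <;> simp [hc] <;> linarith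
  rw [box, Measure.real, (PiLp.volume_preserving_ofLp (Fin (m + 1))).measure_preimage
    measurableSet_Icc.nullMeasurableSet, Real.volume_Icc_pi_toReal hle, Fin.prod_univ_castSucc]
  simp [hc, two_mul]

theorem ball_sdiff_inwardCusp_subset (hγ : 0 < γ) {s : ℝ} (hs : s ≤ 1) :
    ball 0 s \ inwardCusp m γ ⊆
      {x | (∀ i : Fin m, |x i.castSucc| ≤ s ^ γ⁻¹) ∧ |x (Fin.last m)| ≤ s} := by
  rintro x ⟨hx, hxΩ⟩
  have hx' (i) : |x i| < s := (PiLp.norm_apply_le x i).trans_lt (mem_ball_zero_iff.1 hx)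
  have hs0 : 0 ≤ s := (abs_nonneg _).trans (hx' (Fin.last m)).le
  have above : ‖horizontal x‖ ^ γ ≤ x (Fin.last m) := by
    rw [← cuspProfile_of_nonneg hγ (norm_nonneg _)]
    exact not_lt.1 fun h => hxΩ ⟨fun i => abs_lt.1 ((hx' i).trans_le hs), h⟩
  refine ⟨fun i => (abs_le_norm_horizontal x i).trans ?_, (hx' _).le⟩
  rw [Real.le_rpow_inv_iff_of_pos (norm_nonneg _) hs0 hγ]
  exact above.trans ((le_abs_self _).trans (hx' _).le)

theorem volume_real_ball_sdiff_inwardCusp_le (hγ : 0 < γ) {s : ℝ} (hs : 0 < s) (hs1 : s ≤ 1) :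
    volume.real (ball 0 s \ inwardCusp m γ) ≤ 2 ^ m * 2 * s ^ (γ⁻¹ * m + 1) := by
  have hbox : Bornology.IsBounded
      {x : Euc (m + 1) | (∀ i : Fin m, |x i.castSucc| ≤ s ^ γ⁻¹) ∧ |x (Fin.last m)| ≤ s} := by
    let c : Fin (m + 1) → ℝ := Fin.snoc (fun _ => s ^ γ⁻¹) s
    refine (isBounded_setOf_forall_mem_Icc (-c) c).subset fun x hx => ?_
    refine Fin.lastCases ?_ fun i => ?_
    · simpa [c, ← abs_le] using hx.2
    · simpa [c, ← abs_le] using hx.1 i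
  calc volume.real (ball 0 s \ inwardCusp m γ) ≤ (2 * s ^ γ⁻¹) ^ m * (2 * s) := by
        rw [← volume_real_setOf_abs_castSucc_le_abs_last_le (by positivity) hs.le]
        exact measureReal_mono (ball_sdiff_inwardCusp_subset hγ hs1) hbox.measure_lt_top.ne
    _ = _ := by
        rw [Real.rpow_add_one hs.ne', Real.rpow_mul hs.le, Real.rpow_natCast, mul_pow]
        ring

/-- The bound `γ < m (p - 1)` makes the cusp thin, and `m (p - 1) < 1` puts the point source in
`L^p`. -/
theorem hasNonextendableField_inwardCusp {p : ℝ} (hp : 1 ≤ p) (hγ : 0 < γ)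
    (hγp : γ < m * (p - 1)) (hpm : m * (p - 1) < 1) :
    HasNonextendableField (ENNReal.ofReal p) (inwardCusp m γ) := by
  refine hasNonextendableField_pointSource hp (by push_cast; linarith)
    (isOpen_inwardCusp hγ).measurableSet isBounded_inwardCusp zero_notMem_inwardCusp
    zero_mem_closure_inwardCusp ?_
  have hq : 0 ≤ 1 - 1 / p := sub_nonneg.2 (div_le_one_of_le₀ hp (by linarith))
  have exponent : 1 < (γ⁻¹ * m + 1) * (1 - 1 / p) := by
    have : (γ⁻¹ * m + 1) * (1 - 1 / p) - 1 = (m * (p - 1) - γ) / (γ * p) := by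
      field_simp
      ring
    rw [← sub_pos, this]
    exact div_pos (sub_pos.2 hγp) (by positivity)
  refine tendsto_inv_mul_rpow_of_le (K := 2 ^ m * 2) (.of_forall fun s => measureReal_nonneg) ?_ hq
    exponent
  filter_upwards [Ioo_mem_nhdsGT one_pos] with s ⟨hs0, hs1⟩
  exact volume_real_ball_sdiff_inwardCusp_le hγ hs0 hs1.le

theorem exists_hasNonextendableField_inwardCusp (hm : m ≠ 0) (hγ : 0 < γ) (hγ1 : γ < 1) :
    ∃ p : ℝ≥0∞, 1 < p ∧ p < ⊤ ∧ HasNonextendableField p (inwardCusp m γ) := by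
  have hm0 : (0 : ℝ) < m := by positivity
  obtain ⟨a, hγa, ha1⟩ := exists_between hγ1
  have hp : 1 < 1 + a / m := lt_add_of_pos_right _ (div_pos (hγ.trans hγa) hm0)
  have ha : m * (1 + a / m - 1) = a := by field_simp; ring
  exact ⟨_, by simpa using hp, ENNReal.ofReal_lt_top,
    hasNonextendableField_inwardCusp hp.le hγ (by rwa [ha]) (by rwa [ha])⟩

end CuspGeometry

/-! ### Outward cusps in the plane -/

section PlanarCusp

theorem measurePreserving_coords : MeasurePreserving (fun x : Euc 2 => (x 0, x 1)) :=
  (volume_preserving_finTwoArrow ℝ).comp (PiLp.volume_preserving_ofLp (Fin 2))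

theorem measurableEmbedding_coords : MeasurableEmbedding (fun x : Euc 2 => (x 0, x 1)) :=
  (MeasurableEquiv.finTwoArrow (α := ℝ)).measurableEmbedding.comp
    (MeasurableEquiv.toLp 2 (Fin 2 → ℝ)).symm.measurableEmbedding

theorem integral_mul_apply_zero_apply_one (f g : ℝ → ℝ) :
    ∫ x : Euc 2, f (x 0) * g (x 1) = (∫ a, f a) * ∫ b, g b := by
  rw [measurePreserving_coords.integral_comp measurableEmbedding_coords
    fun z : ℝ × ℝ => f z.1 * g z.2, Measure.volume_eq_prod, integral_prod_mul]

variable {γ : ℝ}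

theorem norm_horizontal_one (x : Euc 2) : ‖horizontal (m := 1) x‖ = |x 0| := by
  rw [EuclideanSpace.norm_eq]
  simp [horizontal, Real.sqrt_sq_eq_abs]

theorem mem_outwardCusp_one (hγ : 0 < γ) {x : Euc 2} :
    x ∈ outwardCusp 1 γ ↔ x 1 ∈ Ioo 0 1 ∧ |x 0| < x 1 ^ γ⁻¹ := by
  have h : x ∈ outwardCusp 1 γ ↔ (∀ i, x i ∈ Ioo (-1 : ℝ) 1) ∧ |x 0| ^ γ < x 1 := by
    rw [← cuspProfile_of_nonneg hγ (abs_nonneg _), ← norm_horizontal_one]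
    rfl
  rw [h, Fin.forall_fin_two]
  constructor
  · rintro ⟨⟨-, h1⟩, hlt⟩
    have hpos : 0 < x 1 := (Real.rpow_nonneg (abs_nonneg _) γ).trans_lt hlt
    exact ⟨⟨hpos, h1.2⟩, (Real.lt_rpow_inv_iff_of_pos (abs_nonneg _) hpos.le hγ).2 hlt⟩
  · rintro ⟨⟨hpos, h1⟩, hlt⟩
    have hx0 : |x 0| < 1 := hlt.trans (Real.rpow_lt_one hpos.le h1 (inv_pos.2 hγ))
    exact ⟨⟨abs_lt.1 hx0, by linarith, h1⟩,
      (Real.lt_rpow_inv_iff_of_pos (abs_nonneg _) hpos.le hγ).1 hlt⟩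

theorem zero_mem_closure_outwardCusp_one (hγ : 0 < γ) : 0 ∈ closure (outwardCusp 1 γ) := by
  refine mem_closure_of_tendsto (tendsto_smul_nhdsGT_zero (EuclideanSpace.single 1 1)) ?_
  filter_upwards [Ioo_mem_nhdsGT one_pos] with t ⟨ht0, ht1⟩
  rw [mem_outwardCusp_one hγ]
  simpa [ht0, ht1] using Real.rpow_pos_of_pos ht0 γ⁻¹

theorem setLIntegral_outwardCusp_one (hγ : 0 < γ) {f : ℝ → ℝ≥0∞} (hf : Measurable f) :
    ∫⁻ x in outwardCusp 1 γ, f (x 1) =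
      ∫⁻ b in Ioo (0 : ℝ) 1, ENNReal.ofReal (2 * b ^ γ⁻¹) * f b := by
  set A : Set (ℝ × ℝ) := {z | z.2 ∈ Ioo 0 1 ∧ |z.1| < z.2 ^ γ⁻¹}
  have hA : MeasurableSet A :=
    (measurable_snd measurableSet_Ioo).inter <|
      measurableSet_lt (f := fun z : ℝ × ℝ => |z.1|) (g := fun z => z.2 ^ γ⁻¹)
        (by fun_prop) (by fun_prop)
  have slice (b : ℝ) : ∫⁻ a, A.indicator (fun z => f z.2) (a, b) =
      (Ioo 0 1).indicator (fun b => ENNReal.ofReal (2 * b ^ γ⁻¹) * f b) b := by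
    by_cases hb : b ∈ Ioo (0 : ℝ) 1
    · have : (fun a => A.indicator (fun z => f z.2) (a, b)) =
          (Ioo (-(b ^ γ⁻¹)) (b ^ γ⁻¹)).indicator fun _ => f b := by
        ext a
        simp [A, indicator, abs_lt, hb.1, hb.2]
      rw [this, lintegral_indicator measurableSet_Ioo, setLIntegral_const, Real.volume_Ioo,
        indicator_of_mem hb, sub_neg_eq_add, ← two_mul, mul_comm]
    · rw [indicator_of_notMem hb]
      exact lintegral_eq_zero_of_ae_eq_zero
        (.of_forall fun a => indicator_of_notMem (fun h => hb h.1) _)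
  have hind : Measurable (A.indicator fun z => f z.2) := (hf.comp measurable_snd).indicator hA
  calc ∫⁻ x in outwardCusp 1 γ, f (x 1)
      = ∫⁻ x : Euc 2, A.indicator (fun z => f z.2) (x 0, x 1) := by
        rw [← lintegral_indicator (isOpen_outwardCusp hγ).measurableSet]
        congr! 2
        simp only [indicator, A, mem_ofPred_eq, mem_outwardCusp_one hγ]
    _ = ∫⁻ b, ∫⁻ a, A.indicator (fun z => f z.2) (a, b) := by
        rw [measurePreserving_coords.lintegral_comp hind, Measure.volume_eq_prod,
          lintegral_prod_symm' _ hind]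
    _ = _ := by simp only [slice, lintegral_indicator measurableSet_Ioo]

/-- The shear flow `(1 / y, 0)` in the plane, with value `0` on the line `y = 0`. -/
noncomputable def shearFlow (x : Euc 2) : Euc 2 := (x 1)⁻¹ • EuclideanSpace.single 0 1

theorem measurable_shearFlow : Measurable shearFlow :=
  (EuclideanSpace.proj (𝕜 := ℝ) (1 : Fin 2)).continuous.measurable.inv.smul_const _

theorem norm_shearFlow (x : Euc 2) : ‖shearFlow x‖ = |x 1|⁻¹ := by
  simp [shearFlow, norm_smul]

theorem divFree_shearFlow {U : Set (Euc 2)} (hU : IsOpen U) (h0 : ∀ x ∈ U, x 1 ≠ 0) :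
    DivFree U shearFlow := by
  refine divFree_smul_const (f := fun x => (x 1)⁻¹) hU
    ((EuclideanSpace.proj (𝕜 := ℝ) (1 : Fin 2)).contDiff.contDiffOn.inv h0) fun x hx => ?_
  have : HasFDerivAt (fun x : Euc 2 => (x 1)⁻¹) _ x := (hasDerivAt_inv (h0 x hx)).comp_hasFDerivAt x
    (EuclideanSpace.proj (𝕜 := ℝ) (1 : Fin 2)).hasFDerivAt
  rw [this.fderiv]
  simp

theorem memLp_shearFlow (hγ : 0 < γ) {p : ℝ} (hp : 0 < p) (hpγ : p < 1 + γ⁻¹) :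
    MemLp shearFlow (ENNReal.ofReal p) (volume.restrict (outwardCusp 1 γ)) := by
  refine ⟨measurable_shearFlow.aestronglyMeasurable, ?_⟩
  rw [eLpNorm_lt_top_iff_lintegral_rpow_enorm_lt_top (by simpa using hp) ENNReal.ofReal_ne_top,
    ENNReal.toReal_ofReal hp.le]
  have hfint : IntegrableOn (fun b : ℝ => 2 * b ^ (γ⁻¹ - p)) (Ioo 0 1) :=
    ((intervalIntegral.integrableOn_Ioo_rpow_iff one_pos).2 (by linarith)).const_mul 2
  have henorm (x : Euc 2) : ‖shearFlow x‖ₑ ^ p = ENNReal.ofReal (|x 1|⁻¹ ^ p) := by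
    rw [← ofReal_norm, norm_shearFlow, ENNReal.ofReal_rpow_of_nonneg (by positivity) hp.le]
  simp only [henorm]
  rw [setLIntegral_outwardCusp_one hγ (f := fun b => ENNReal.ofReal (|b|⁻¹ ^ p)) (by fun_prop)]
  refine lt_of_eq_of_lt (setLIntegral_congr_fun measurableSet_Ioo fun b hb => ?_)
    hfint.lintegral_lt_top
  have hb0 : 0 < b := hb.1
  rw [← ENNReal.ofReal_mul (by positivity), abs_of_pos hb0, Real.inv_rpow hb0.le,
    Real.rpow_sub hb0, mul_assoc, div_eq_mul_inv]

end PlanarCusp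

/-- The smooth step `a ↦ S (a / w)` which rises from `0` to `1` on `[0, w]`. -/
noncomputable def smoothStep (w a : ℝ) : ℝ := Real.smoothTransition (w⁻¹ * a)

section SmoothStep

variable {w a : ℝ}

theorem contDiff_smoothStep (w : ℝ) : ContDiff ℝ ∞ (smoothStep w) :=
  Real.smoothTransition.contDiff.comp (contDiff_const.mul contDiff_id)

theorem norm_smoothStep_le_one (w a : ℝ) : ‖smoothStep w a‖ ≤ 1 := by
  rw [smoothStep, Real.norm_of_nonneg (Real.smoothTransition.nonneg _)]
  exact Real.smoothTransition.le_one _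

theorem smoothStep_of_nonpos (hw : 0 < w) (ha : a ≤ 0) : smoothStep w a = 0 :=
  Real.smoothTransition.zero_of_nonpos (mul_nonpos_of_nonneg_of_nonpos (inv_nonneg.2 hw.le) ha)

theorem smoothStep_of_le (hw : 0 < w) (ha : w ≤ a) : smoothStep w a = 1 :=
  Real.smoothTransition.one_of_one_le (by rwa [le_inv_mul_iff₀ hw, mul_one])

theorem deriv_smoothStep_eq_zero (hw : 0 < w) (ha : a ∉ Icc 0 w) : deriv (smoothStep w) a = 0 := by
  rw [mem_Icc, not_and_or, not_le, not_le] at ha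
  rcases ha with ha | ha
  · refine (EventuallyEq.deriv_eq ?_).trans (deriv_const a (0 : ℝ))
    filter_upwards [Iio_mem_nhds ha] with b hb using smoothStep_of_nonpos hw (le_of_lt hb)
  · refine (EventuallyEq.deriv_eq ?_).trans (deriv_const a (1 : ℝ))
    filter_upwards [Ioi_mem_nhds ha] with b hb using smoothStep_of_le hw (le_of_lt hb)

theorem integral_deriv_smoothStep (hw : 0 < w) : ∫ a, deriv (smoothStep w) a = 1 := by
  have hfint : Integrable (deriv (smoothStep w)) :=
    ((contDiff_smoothStep w).continuous_deriv (by simp)).integrable_of_hasCompactSupport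
      (.intro isCompact_Icc fun _ => deriv_smoothStep_eq_zero hw)
  have hbot : Tendsto (smoothStep w) atBot (𝓝 0) := tendsto_const_nhds.congr' <| by
    filter_upwards [eventually_le_atBot 0] with a ha using (smoothStep_of_nonpos hw ha).symm
  have htop : Tendsto (smoothStep w) atTop (𝓝 1) := tendsto_const_nhds.congr' <| by
    filter_upwards [eventually_ge_atTop w] with a ha using (smoothStep_of_le hw ha).symm
  rw [integral_of_hasDerivAt_of_tendsto
    (fun a => ((contDiff_smoothStep w).differentiable (by simp) a).hasDerivAt) hfint hbot htop,
    sub_zero]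

end SmoothStep

/-- A plateau on `[-3, 3]`, the horizontal profile of `cuspCutoff`. -/
noncomputable def plateau : ContDiffBump (0 : ℝ) := ⟨3, 4, by norm_num, by norm_num⟩

/-- A bump supported in `(1, 3)`, the vertical profile of `cuspCutoff`. -/
noncomputable def heightBump : ContDiffBump (2 : ℝ) := ⟨1 / 2, 1, by norm_num, by norm_num⟩

/-- A cutoff in the plane, supported away from the line `y = 0` and independent of the horizontal
coordinate `a` as long as `|a| < 3`. -/
noncomputable def cuspCutoff (x : Euc 2) : ℝ := plateau (x 0) * heightBump (x 1)

section CuspCutoff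

variable {a b s w : ℝ} {x : Euc 2}

theorem plateau_eq_one (ha : |a| ≤ 3) : plateau a = 1 :=
  plateau.one_of_mem_closedBall (by simpa [plateau] using ha)

theorem deriv_plateau_eq_zero (ha : |a| < 3) : deriv plateau a = 0 :=
  (plateau.eventuallyEq_one_of_mem_ball (by simpa [plateau] using ha)).deriv_eq.trans
    (deriv_const a 1)

theorem mem_Ioo_of_heightBump_ne_zero (hb : heightBump b ≠ 0) : b ∈ Ioo 1 3 := by
  have : b ∈ Function.support heightBump := hb
  rw [heightBump.support_eq, Real.ball_eq_Ioo] at this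
  norm_num [heightBump] at this
  exact this

theorem contDiff_cuspCutoff : ContDiff ℝ ∞ cuspCutoff :=
  (plateau.contDiff.comp (EuclideanSpace.proj (𝕜 := ℝ) (0 : Fin 2)).contDiff).mul
    (heightBump.contDiff.comp (EuclideanSpace.proj (𝕜 := ℝ) (1 : Fin 2)).contDiff)

theorem hasCompactSupport_cuspCutoff : HasCompactSupport cuspCutoff := by
  refine .intro (K := WithLp.toLp 2 '' univ.pi ![closedBall 0 4, closedBall 2 1]) ?_ fun x hx => ?_
  · refine (isCompact_univ_pi fun i => ?_).image (PiLp.continuous_toLp 2 _)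
    fin_cases i <;> exact isCompact_closedBall _ _
  · contrapose! hx
    obtain ⟨h0, h1⟩ := mul_ne_zero_iff.1 hx
    refine ⟨x.ofLp, fun i _ => ?_, rfl⟩
    fin_cases i
    · exact ball_subset_closedBall (plateau.support_eq.subset h0)
    · exact ball_subset_closedBall (heightBump.support_eq.subset h1)

theorem hasFDerivAt_comp_apply {n : ℕ} {f : ℝ → ℝ} (hf : Differentiable ℝ f) (i : Fin n)
    (x : Euc n) : HasFDerivAt (fun x : Euc n => f (x i))
      (deriv f (x i) • (EuclideanSpace.proj i : Euc n →L[ℝ] ℝ)) x :=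
  (hf (x i)).hasDerivAt.comp_hasFDerivAt x (EuclideanSpace.proj i : Euc n →L[ℝ] ℝ).hasFDerivAt

theorem fderiv_comp_apply_mul {n : ℕ} {f : ℝ → ℝ} {χ : Euc n → ℝ} (hf : Differentiable ℝ f)
    (hχ : Differentiable ℝ χ) (i : Fin n) (x v : Euc n) :
    fderiv ℝ (fun x => f (x i) * χ x) x v =
      deriv f (x i) * v i * χ x + f (x i) * fderiv ℝ χ x v := by
  rw [((hasFDerivAt_comp_apply hf i x).fun_mul (hχ x).hasFDerivAt).fderiv]
  simp
  ring

theorem fderiv_cuspCutoff_single_zero (h : heightBump (x 1) ≠ 0 → |x 0| < 3) :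
    fderiv ℝ cuspCutoff x (EuclideanSpace.single 0 1) = 0 := by
  have hχ (x : Euc 2) := hasFDerivAt_comp_apply
    ((heightBump.contDiff (n := 1)).differentiable one_ne_zero) 1 x
  have hprod : fderiv ℝ cuspCutoff x (EuclideanSpace.single 0 1) =
      deriv plateau (x 0) * heightBump (x 1) := by
    refine (fderiv_comp_apply_mul ((plateau.contDiff (n := 1)).differentiable one_ne_zero)
      (fun x => (hχ x).differentiableAt) 0 x _).trans ?_
    rw [(hχ x).fderiv]
    simp
  by_cases hb : heightBump (x 1) = 0
  · rw [hprod, hb, mul_zero]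
  · rw [hprod, deriv_plateau_eq_zero (h hb), zero_mul]

theorem integral_heightBump_mul_inv_pos : 0 < ∫ b : ℝ, heightBump b * b⁻¹ := by
  have hpos {b : ℝ} (hb : heightBump b ≠ 0) : 0 < b :=
    one_pos.trans (mem_Ioo_of_heightBump_ne_zero hb).1
  have hcont : Continuous fun b : ℝ => heightBump b * b⁻¹ := continuous_of_tsupport fun b hb => by
    have hb' : b ∈ closedBall 2 1 := heightBump.tsupport_eq ▸ tsupport_mul_subset_left hb
    refine heightBump.continuous.continuousAt.mul (continuousAt_inv₀ ?_)
    rintro rfl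
    norm_num at hb'
  refine hcont.integral_pos_of_hasCompactSupport_nonneg_nonzero
    heightBump.hasCompactSupport.mul_right (fun b => ?_) (x := 2) ?_
  · by_cases hb : heightBump b = 0
    · simp [hb]
    · exact mul_nonneg heightBump.nonneg (inv_nonneg.2 (hpos hb).le)
  · rw [heightBump.one_of_mem_closedBall (mem_closedBall_self heightBump.rIn_pos.le)]
    norm_num

theorem integral_heightBump_inv_mul_mul_inv (hs : 0 < s) :
    ∫ b : ℝ, heightBump (s⁻¹ * b) * b⁻¹ = ∫ b : ℝ, heightBump b * b⁻¹ := by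
  have hscale : (fun b => heightBump (s⁻¹ * b) * b⁻¹) =
      fun b => s⁻¹ * (heightBump (s⁻¹ * b) * (s⁻¹ * b)⁻¹) := by
    ext b
    rw [mul_inv]
    field_simp
  rw [hscale, integral_const_mul, Measure.integral_comp_inv_mul_left
    (fun b : ℝ => heightBump b * b⁻¹), abs_of_pos hs, smul_eq_mul, inv_mul_cancel_left₀ hs.ne']

end CuspCutoff

/-- The test function for the cusp at scale `s`: it rises from `0` to `1` across the right half of
the section of the cusp at height `s`. -/
noncomputable def cuspTest (γ s : ℝ) (x : Euc 2) : ℝ :=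
  smoothStep (s ^ γ⁻¹) (x 0) * dilate s cuspCutoff x

section CuspTest

variable {γ s : ℝ} {x : Euc 2}

theorem fderiv_cuspTest (γ s : ℝ) (x v : Euc 2) : fderiv ℝ (cuspTest γ s) x v =
    deriv (smoothStep (s ^ γ⁻¹)) (x 0) * v 0 * dilate s cuspCutoff x +
      smoothStep (s ^ γ⁻¹) (x 0) * fderiv ℝ (dilate s cuspCutoff) x v :=
  fderiv_comp_apply_mul ((contDiff_smoothStep _).differentiable (by simp))
    ((contDiff_dilate contDiff_cuspCutoff s).differentiable (by simp)) 0 x v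

theorem height_mem_Ioo_of_dilate_ne_zero (hs : 0 < s) (h : heightBump (s⁻¹ * x 1) ≠ 0) :
    x 1 ∈ Ioo s (3 * s) := by
  obtain ⟨h1, h2⟩ := mem_Ioo_of_heightBump_ne_zero h
  rw [lt_inv_mul_iff₀ hs, mul_one] at h1
  rw [inv_mul_lt_iff₀ hs, mul_comm] at h2
  exact ⟨h1, h2⟩

/-- The step of the test function takes place inside the cusp. -/
theorem deriv_smoothStep_mul_heightBump_eq_zero (hγ : 0 < γ) (hs : 0 < s) (hs1 : 3 * s ≤ 1)
    (hx : x ∉ outwardCusp 1 γ) :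
    deriv (smoothStep (s ^ γ⁻¹)) (x 0) * heightBump (s⁻¹ * x 1) = 0 := by
  by_contra! h
  obtain ⟨hS, hH⟩ := mul_ne_zero_iff.1 h
  have ⟨hx0, hx0w⟩ : x 0 ∈ Icc 0 (s ^ γ⁻¹) := not_imp_comm.1
    (deriv_smoothStep_eq_zero (Real.rpow_pos_of_pos hs _)) hS
  obtain ⟨hx1, hx1'⟩ := height_mem_Ioo_of_dilate_ne_zero hs hH
  refine hx ((mem_outwardCusp_one hγ).2 ⟨⟨hs.trans hx1, hx1'.trans_le hs1⟩, ?_⟩)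
  rw [abs_of_nonneg hx0]
  exact hx0w.trans_lt (Real.rpow_lt_rpow hs.le hx1 (inv_pos.2 hγ))

theorem isTestFunctionAtScale_cuspTest {R C : ℝ} (hR : tsupport cuspCutoff ⊆ ball 0 R)
    (hC : ∀ x, ‖fderiv ℝ cuspCutoff x‖ ≤ C) (hγ : 0 < γ) (hs : 0 < s) (hs1 : 3 * s ≤ 1) :
    IsTestFunctionAtScale (outwardCusp 1 γ) R C s (cuspTest γ s) where
  contDiff := ((contDiff_smoothStep _).comp (EuclideanSpace.proj (𝕜 := ℝ) (0 : Fin 2)).contDiff).mul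
    (contDiff_dilate contDiff_cuspCutoff s)
  hasCompactSupport := (hasCompactSupport_dilate hasCompactSupport_cuspCutoff hs.ne').mul_left
  tsupport_subset := tsupport_mul_subset_right.trans (tsupport_dilate_subset hR hs)
  norm_fderiv_le x hx := by
    have step : deriv (smoothStep (s ^ γ⁻¹)) (x 0) * dilate s cuspCutoff x = 0 := by
      simp only [dilate, cuspCutoff, PiLp.smul_apply, smul_eq_mul]
      rw [mul_left_comm, deriv_smoothStep_mul_heightBump_eq_zero hγ hs hs1 hx, mul_zero]
    have : fderiv ℝ (cuspTest γ s) x =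
        smoothStep (s ^ γ⁻¹) (x 0) • fderiv ℝ (dilate s cuspCutoff) x := by
      ext v
      rw [fderiv_cuspTest, mul_right_comm, step, zero_mul, zero_add]
      rfl
    rw [this, norm_smul]
    exact (mul_le_of_le_one_left (norm_nonneg _) (norm_smoothStep_le_one _ _)).trans
      (norm_fderiv_dilate_le hC hs.le x)

theorem fderiv_cuspTest_shearFlow (hγ : 0 < γ) (hγ1 : γ ≤ 1) (hs : 0 < s) (hs1 : 3 * s ≤ 1)
    (x : Euc 2) :
    fderiv ℝ (cuspTest γ s) x ((outwardCusp 1 γ).indicator shearFlow x) =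
      deriv (smoothStep (s ^ γ⁻¹)) (x 0) * (heightBump (s⁻¹ * x 1) * (x 1)⁻¹) := by
  by_cases hx : x ∈ outwardCusp 1 γ
  swap
  · rw [indicator_of_notMem hx, map_zero, ← mul_assoc,
      deriv_smoothStep_mul_heightBump_eq_zero hγ hs hs1 hx, zero_mul]
  obtain ⟨⟨hx1, hx1'⟩, hx0⟩ := (mem_outwardCusp_one hγ).1 hx
  have hlow (h : heightBump (s⁻¹ * x 1) ≠ 0) : |s⁻¹ * x 0| < 3 := by
    rw [abs_mul, abs_inv, abs_of_pos hs, inv_mul_lt_iff₀ hs, mul_comm]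
    exact (hx0.trans_le (Real.rpow_le_self_of_le_one hx1.le hx1'.le ((one_le_inv₀ hγ).2 hγ1))).trans
      (height_mem_Ioo_of_dilate_ne_zero hs h).2
  have cutoff : dilate s cuspCutoff x = heightBump (s⁻¹ * x 1) := by
    simp only [dilate, cuspCutoff, PiLp.smul_apply, smul_eq_mul]
    by_cases h : heightBump (s⁻¹ * x 1) = 0
    · rw [h, mul_zero]
    · rw [plateau_eq_one (hlow h).le, one_mul]
  have horiz : fderiv ℝ (dilate s cuspCutoff) x (EuclideanSpace.single 0 1) = 0 := by
    have : fderiv ℝ (dilate s cuspCutoff) x = s⁻¹ • fderiv ℝ cuspCutoff (s⁻¹ • x) :=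
      fderiv_comp_smul s⁻¹
    rw [this, smul_apply, fderiv_cuspCutoff_single_zero (by simpa using hlow), smul_zero]
  rw [indicator_of_mem hx, shearFlow, map_smul, fderiv_cuspTest, cutoff, horiz]
  simp only [PiLp.single_eq_same, mul_one, mul_zero, add_zero, smul_eq_mul]
  ring

theorem integral_fderiv_cuspTest_shearFlow (hγ : 0 < γ) (hγ1 : γ ≤ 1) (hs : 0 < s)
    (hs1 : 3 * s ≤ 1) :
    ∫ x, fderiv ℝ (cuspTest γ s) x ((outwardCusp 1 γ).indicator shearFlow x) =
      ∫ b : ℝ, heightBump b * b⁻¹ := by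
  simp only [fderiv_cuspTest_shearFlow hγ hγ1 hs hs1]
  rw [integral_mul_apply_zero_apply_one (deriv (smoothStep (s ^ γ⁻¹)))
    (fun b => heightBump (s⁻¹ * b) * b⁻¹), integral_deriv_smoothStep (Real.rpow_pos_of_pos hs _),
    one_mul, integral_heightBump_inv_mul_mul_inv hs]

end CuspTest

theorem hasNonextendableField_outwardCusp_one {γ p : ℝ} (hγ : 0 < γ) (hγ1 : γ ≤ 1) (hp : 2 < p)
    (hpγ : p < 1 + γ⁻¹) : HasNonextendableField (ENNReal.ofReal p) (outwardCusp 1 γ) := by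
  have hΩ := (isOpen_outwardCusp (m := 1) hγ).measurableSet
  obtain ⟨C, hC0, hC⟩ := exists_norm_fderiv_le_of_hasCompactSupport
    (contDiff_cuspCutoff.of_le (by simp)) hasCompactSupport_cuspCutoff
  obtain ⟨R, hR0, hR⟩ := hasCompactSupport_cuspCutoff.isCompact.isBounded.subset_ball_lt 0 0
  have small : ∀ᶠ s in 𝓝[>] (0 : ℝ), 0 < s ∧ 3 * s ≤ 1 := by
    filter_upwards [Ioo_mem_nhdsGT (show (0 : ℝ) < 1 / 3 by norm_num)] with s ⟨h0, h1⟩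
    exact ⟨h0, by linarith⟩
  have memLp : MemLp ((outwardCusp 1 γ).indicator shearFlow) (ENNReal.ofReal p) :=
    (memLp_indicator_iff_restrict hΩ).2 (memLp_shearFlow hγ (by linarith) hpγ)
  have divFree : DivFree (outwardCusp 1 γ) ((outwardCusp 1 γ).indicator shearFlow) :=
    (divFree_shearFlow (isOpen_outwardCusp hγ)
      fun x hx => ((mem_outwardCusp_one hγ).1 hx).1.1.ne').congr_ae (indicator_ae_eq_restrict hΩ)
  refine hasNonextendableField_of_thin_compl (φ := cuspTest γ) (by simpa using by linarith) hΩ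
    (zero_mem_closure_outwardCusp_one hγ) (fun η _ => memLp.restrict _) divFree
    (small.mono fun s hs => isTestFunctionAtScale_cuspTest hR hC hγ hs.1 hs.2) hC0
    (small.mono fun s hs => integral_fderiv_cuspTest_shearFlow hγ hγ1 hs.1 hs.2)
    integral_heightBump_mul_inv_pos.ne' ?_
  rw [ENNReal.toReal_ofReal (by linarith)]
  have hp2 : 2 * (1 / p) < 1 := by
    rw [mul_one_div]
    exact (div_lt_one (by linarith)).2 hp
  refine tendsto_inv_mul_rpow_of_le (K := R ^ 2 * volume.real (ball (0 : Euc 2) 1)) (a := 2)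
    (.of_forall fun s => measureReal_nonneg) (small.mono fun s hs => ?_)
    (by linarith) (by linarith)
  refine (measureReal_mono sdiff_subset measure_ball_lt_top.ne).trans_eq ?_
  have hRs : 0 ≤ R * s := mul_nonneg hR0.le hs.1.le
  rw [Measure.real, Measure.addHaar_ball volume 0 hRs, ENNReal.toReal_mul,
    ENNReal.toReal_ofReal (by positivity), finrank_euclideanSpace, Fintype.card_fin, Real.rpow_two,
    Measure.real]
  ring

theorem exists_hasNonextendableField_outwardCusp_one {γ : ℝ} (hγ : 0 < γ) (hγ1 : γ < 1) :
    ∃ p : ℝ≥0∞, 1 ≤ p ∧ p < ⊤ ∧ HasNonextendableField p (outwardCusp 1 γ) := by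
  obtain ⟨p, hp, hpγ⟩ := exists_between (show 2 < 1 + γ⁻¹ by linarith [(one_lt_inv₀ hγ).2 hγ1])
  exact ⟨ENNReal.ofReal p, by simpa using by linarith, ENNReal.ofReal_lt_top,
    hasNonextendableField_outwardCusp_one hγ hγ1.le hp hpγ⟩

/-! ### A criterion for `(ε, δ)`-domains -/

section EpsDelta

theorem le_infEDist_frontier_of_ball_subset {X : Type*} [PseudoMetricSpace X] {Ω : Set X}
    (hΩ : IsOpen Ω) {x : X} {r : ℝ} (h : ball x r ⊆ Ω) :
    ENNReal.ofReal r ≤ infEDist x (frontier Ω) := by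
  refine le_infEDist.2 fun y hy => ?_
  by_contra! hlt
  rw [hΩ.frontier_eq] at hy
  exact hy.2 (h (by rwa [mem_ball', ← edist_lt_ofReal]))

theorem infEDist_frontier_pos {X : Type*} [PseudoMetricSpace X] {Ω : Set X} (hΩ : IsOpen Ω) {x : X}
    (hx : x ∈ Ω) : 0 < infEDist x (frontier Ω) := by
  rw [infEDist_pos_iff_notMem_closure, isClosed_frontier.closure_eq]
  exact fun h => (hΩ.inter_frontier_eq ▸ ⟨hx, h⟩ : x ∈ (∅ : Set X))

variable {X : Type*} [PseudoMetricSpace X] {K : ℝ≥0} {c : ℝ → X}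

theorem eVariationOn_unitInterval_le (hc : LipschitzOnWith K c unitInterval) :
    eVariationOn (fun t : unitInterval => c t) univ ≤ K := by
  have hval : eVariationOn (Subtype.val : unitInterval → ℝ) univ ≤ 1 := by
    have h := MonotoneOn.eVariationOn_eq (f := (Subtype.val : unitInterval → ℝ)) (s := univ)
      (fun _ _ _ _ h => h) (mem_univ 0) (mem_univ 1)
    rw [univ_inter, ← unitInterval.univ_eq_Icc] at h
    simpa using h.le
  calc eVariationOn (c ∘ (Subtype.val : unitInterval → ℝ)) univ
      ≤ K * eVariationOn (Subtype.val : unitInterval → ℝ) univ :=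
        hc.comp_eVariationOn_le (s := univ) fun t _ => t.2
    _ ≤ K * 1 := by gcongr
    _ = K := mul_one _

theorem dist_mul_dist_le_of_lipschitzOnWith (hc : LipschitzOnWith K c unitInterval) {t : ℝ}
    (ht : t ∈ unitInterval) : dist (c 0) (c t) * dist (c 1) (c t) ≤ K ^ 2 * (t * (1 - t)) := by
  have h0 : dist (c 0) (c t) ≤ K * t := by
    simpa [abs_of_nonneg ht.1] using hc.dist_le_mul 0 unitInterval.zero_mem t ht
  have h1 : dist (c 1) (c t) ≤ K * (1 - t) := by
    simpa [Real.dist_eq, abs_of_nonneg (sub_nonneg.2 ht.2)] using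
      hc.dist_le_mul 1 unitInterval.one_mem t ht
  calc dist (c 0) (c t) * dist (c 1) (c t) ≤ (K * t) * (K * (1 - t)) := by
        gcongr
        exact mul_nonneg K.2 ht.1
    _ = K ^ 2 * (t * (1 - t)) := by ring

theorem mem_of_ball_subset_of_mem_unitInterval {Ω : Set X} {r : ℝ} (hr : 0 < r) (h0 : c 0 ∈ Ω)
    (h1 : c 1 ∈ Ω) (hball : ∀ t ∈ Ioo (0 : ℝ) 1, ball (c t) (r * (t * (1 - t))) ⊆ Ω) {t : ℝ}
    (ht : t ∈ unitInterval) : c t ∈ Ω := by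
  rcases eq_endpoints_or_mem_Ioo_of_mem_Icc ht with rfl | rfl | ht
  · exact h0
  · exact h1
  · exact hball t ht (mem_ball_self (mul_pos hr (mul_pos ht.1 (sub_pos.2 ht.2))))

theorem ofReal_dist_mul_dist_lt_infEDist_mul_edist {Ω : Set X} (hΩ : IsOpen Ω) {ε r : ℝ}
    (hε : 0 ≤ ε) (hc : LipschitzOnWith K c unitInterval) (h0 : c 0 ∈ Ω) (h1 : c 1 ∈ Ω)
    (hd : 0 < dist (c 0) (c 1)) (hr : 0 < r) (hεr : ε * K ^ 2 < r * dist (c 0) (c 1))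
    (hball : ∀ t ∈ Ioo (0 : ℝ) 1, ball (c t) (r * (t * (1 - t))) ⊆ Ω) {t : ℝ}
    (ht : t ∈ unitInterval) :
    ENNReal.ofReal (ε * (dist (c 0) (c t) * dist (c 1) (c t))) <
      infEDist (c t) (frontier Ω) * edist (c 0) (c 1) := by
  have hpos : 0 < infEDist (c t) (frontier Ω) * edist (c 0) (c 1) :=
    ENNReal.mul_pos (infEDist_frontier_pos hΩ
      (mem_of_ball_subset_of_mem_unitInterval hr h0 h1 hball ht)).ne'
      (by rwa [edist_dist, Ne, ENNReal.ofReal_eq_zero, not_le])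
  rcases eq_endpoints_or_mem_Ioo_of_mem_Icc ht with rfl | rfl | ht'
  · simpa using hpos
  · simpa using hpos
  have htt : 0 < t * (1 - t) := mul_pos ht'.1 (sub_pos.2 ht'.2)
  have hlt : ε * (dist (c 0) (c t) * dist (c 1) (c t)) <
      r * (t * (1 - t)) * dist (c 0) (c 1) := by
    calc ε * (dist (c 0) (c t) * dist (c 1) (c t)) ≤ ε * (K ^ 2 * (t * (1 - t))) := by
          gcongr ε * ?_
          exact dist_mul_dist_le_of_lipschitzOnWith hc ht
      _ = (ε * K ^ 2) * (t * (1 - t)) := by ring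
      _ < (r * dist (c 0) (c 1)) * (t * (1 - t)) := by gcongr
      _ = r * (t * (1 - t)) * dist (c 0) (c 1) := by ring
  calc ENNReal.ofReal (ε * (dist (c 0) (c t) * dist (c 1) (c t)))
      < ENNReal.ofReal (r * (t * (1 - t)) * dist (c 0) (c 1)) :=
        (ENNReal.ofReal_lt_ofReal_iff (by positivity)).2 hlt
    _ = ENNReal.ofReal (r * (t * (1 - t))) * edist (c 0) (c 1) := by
        rw [edist_dist, ENNReal.ofReal_mul (by positivity)]
    _ ≤ infEDist (c t) (frontier Ω) * edist (c 0) (c 1) := by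
        gcongr
        exact le_infEDist_frontier_of_ball_subset hΩ (hball t ht')

end EpsDelta

theorem isEpsDeltaDomain_of_lipschitzOnWith {n : ℕ} {Ω : Set (Euc n)} (hΩ : IsOpen Ω) {L : ℝ≥0}
    {κ δ : ℝ} (hL : 1 ≤ L) (hκ : 0 < κ) (hκ1 : κ ≤ 1) (hδ : 0 < δ)
    (h : ∀ x ∈ Ω, ∀ y ∈ Ω, x ≠ y → dist x y < δ → ∃ c : ℝ → Euc n, c 0 = x ∧ c 1 = y ∧
      LipschitzOnWith (L * nndist x y) c unitInterval ∧
      ∀ t ∈ Ioo (0 : ℝ) 1, ball (c t) (κ * dist x y * (t * (1 - t))) ⊆ Ω) :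
    IsEpsDeltaDomain (κ / (2 * L ^ 2)) (ENNReal.ofReal δ) Ω := by
  have : (1 : ℝ) ≤ L := hL
  refine ⟨by positivity, by simpa using hδ, hΩ, fun x hx y hy hxy hlt => ?_⟩
  have hd : 0 < dist x y := dist_pos.2 hxy
  rw [edist_lt_ofReal] at hlt
  obtain ⟨c, rfl, rfl, hlip, hball⟩ := h x hx y hy hxy hlt
  refine ⟨⟨⟨fun t : unitInterval => c t, hlip.continuousOn.domRestrict⟩, by simp, by simp⟩,
    fun t => mem_of_ball_subset_of_mem_unitInterval (by positivity) hx hy hball t.2,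
    (eVariationOn_unitInterval_le hlip).trans_lt ?_, fun t =>
      ofReal_dist_mul_dist_lt_infEDist_mul_edist hΩ (by positivity) hlip hx hy hd (by positivity)
        ?_ hball t.2⟩
  · rw [← ENNReal.ofReal_coe_nnreal, ENNReal.ofReal_lt_ofReal_iff (by positivity),
      NNReal.coe_mul, coe_nndist, lt_div_iff₀ (by positivity)]
    calc L * dist (c 0) (c 1) * (κ / (2 * L ^ 2)) = dist (c 0) (c 1) * (κ / (2 * L)) := by
          field_simp
      _ < dist (c 0) (c 1) :=
          mul_lt_of_lt_one_right hd ((div_lt_one (by positivity)).2 (by linarith))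
  · calc κ / (2 * L ^ 2) * (L * nndist (c 0) (c 1) : ℝ≥0) ^ 2
        = κ * dist (c 0) (c 1) * dist (c 0) (c 1) / 2 := by
          push_cast
          field_simp
      _ < κ * dist (c 0) (c 1) * dist (c 0) (c 1) := half_lt_self (by positivity)

/-! ### Curves of prescribed norm -/

section UnitInterval

theorem mul_one_sub_mem_Icc {t : ℝ} (ht : t ∈ unitInterval) : t * (1 - t) ∈ Icc (0 : ℝ) (1 / 4) :=
  ⟨mul_nonneg ht.1 (sub_nonneg.2 ht.2), by nlinarith [sq_nonneg (t - 1 / 2)]⟩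

theorem lipschitzOnWith_mul_mul_one_sub (d : ℝ≥0) :
    LipschitzOnWith d (fun t : ℝ => d * (t * (1 - t))) unitInterval := by
  refine LipschitzOnWith.of_dist_le_mul fun s hs t ht => ?_
  rw [Real.dist_eq, Real.dist_eq,
    show d * (s * (1 - s)) - d * (t * (1 - t)) = d * ((1 - s - t) * (s - t)) by ring, abs_mul,
    abs_mul, NNReal.abs_eq]
  gcongr
  refine mul_le_of_le_one_left (abs_nonneg _) (abs_le.2 ⟨?_, ?_⟩) <;>
    linarith [hs.1, hs.2, ht.1, ht.2]

theorem lipschitzOnWith_smul {X E : Type*} [PseudoMetricSpace X] [SeminormedAddCommGroup E]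
    [NormedSpace ℝ E] {f : X → ℝ} {g : X → E} {s : Set X} {K L M N : ℝ≥0}
    (hf : LipschitzOnWith K f s) (hg : LipschitzOnWith L g s) (hfM : ∀ x ∈ s, |f x| ≤ M)
    (hgN : ∀ x ∈ s, ‖g x‖ ≤ N) : LipschitzOnWith (K * N + M * L) (fun x => f x • g x) s := by
  refine LipschitzOnWith.of_dist_le_mul fun x hx y hy => ?_
  calc dist (f x • g x) (f y • g y) = ‖(f x - f y) • g x + f y • (g x - g y)‖ := by
        rw [dist_eq_norm]
        congr 1
        module
    _ ≤ |f x - f y| * ‖g x‖ + |f y| * ‖g x - g y‖ := by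
        simpa only [norm_smul, Real.norm_eq_abs] using
          norm_add_le ((f x - f y) • g x) (f y • (g x - g y))
    _ ≤ K * dist x y * N + M * (L * dist x y) := by
        gcongr
        · exact hf.dist_le_mul x hx y hy
        · exact hgN x hx
        · exact hfM y hy
        · exact (dist_eq_norm (g x) (g y)).symm.trans_le (hg.dist_le_mul x hx y hy)
    _ = (K * N + M * L : ℝ≥0) * dist x y := by
        push_cast
        ring

theorem norm_le_of_lipschitzOnWith_of_eq_zero {E : Type*} [SeminormedAddCommGroup E] {g : ℝ → E}
    {K : ℝ≥0} (hg : LipschitzOnWith K g unitInterval) (h0 : g 0 = 0) (h1 : g 1 = 0) {t : ℝ}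
    (ht : t ∈ unitInterval) : ‖g t‖ ≤ 2 * K * (t * (1 - t)) := by
  have ht' : 0 ≤ 1 - t := sub_nonneg.2 ht.2
  have hle : ‖g t‖ ≤ K * t := by
    simpa [h0, abs_of_nonneg ht.1] using hg.dist_le_mul t ht 0 unitInterval.zero_mem
  have hle' : ‖g t‖ ≤ K * (1 - t) := by
    simpa [h1, Real.dist_eq, abs_sub_comm t, abs_of_nonneg ht'] using
      hg.dist_le_mul t ht 1 unitInterval.one_mem
  calc ‖g t‖ = (1 - t) * ‖g t‖ + t * ‖g t‖ := by ring
    _ ≤ (1 - t) * (K * t) + t * (K * (1 - t)) := by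
        gcongr
        exact ht.1
    _ = 2 * K * (t * (1 - t)) := by ring

/-- The parabola over `[0, 1]` from `a` at `0` to `b` at `1` which lies `d * t * (1 - t)` above the
chord: the radius of curves kept away from an axis. -/
def raisedLerp (a b d t : ℝ) : ℝ := AffineMap.lineMap a b t + d * (t * (1 - t))

@[simp] theorem raisedLerp_zero (a b d : ℝ) : raisedLerp a b d 0 = a := by simp [raisedLerp]

@[simp] theorem raisedLerp_one (a b d : ℝ) : raisedLerp a b d 1 = b := by simp [raisedLerp]

theorem raisedLerp_mem_Icc {a b : ℝ} {d : ℝ≥0} (ha : 0 ≤ a) (hb : 0 ≤ b) {t : ℝ}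
    (ht : t ∈ unitInterval) : raisedLerp a b d t ∈ Icc 0 (max a b + d / 4) := by
  have ht' : 0 ≤ 1 - t := sub_nonneg.2 ht.2
  have hq := (mul_one_sub_mem_Icc ht).2
  rw [raisedLerp, AffineMap.lineMap_apply_ring]
  constructor
  · have := ht.1
    positivity
  · calc (1 - t) * a + t * b + d * (t * (1 - t))
        ≤ (1 - t) * max a b + t * max a b + d * (1 / 4) := by
          gcongr
          exacts [le_max_left a b, ht.1, le_max_right a b]
      _ = max a b + d / 4 := by ring

theorem lipschitzOnWith_raisedLerp {a b : ℝ} {d : ℝ≥0} (hd : nndist a b ≤ d) :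
    LipschitzOnWith (2 * d) (raisedLerp a b d) unitInterval := by
  rw [two_mul]
  exact ((lipschitzWith_lineMap a b).weaken hd).lipschitzOnWith.add
    (lipschitzOnWith_mul_mul_one_sub d)

end UnitInterval

section GreatCircle

variable {E : Type*} [NormedAddCommGroup E] [InnerProductSpace ℝ E]

theorem exists_norm_eq_one_smul_norm_eq {F : Type*} [NormedAddCommGroup F] [NormedSpace ℝ F]
    [Nontrivial F] (x : F) : ∃ u : F, ‖u‖ = 1 ∧ ‖x‖ • u = x := by
  by_cases hx : x = 0
  · obtain ⟨u, hu⟩ := exists_norm_eq F zero_le_one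
    exact ⟨u, hu, by simp [hx]⟩
  · exact ⟨‖x‖⁻¹ • x, norm_smul_inv_norm hx, smul_inv_smul₀ (norm_ne_zero_iff.2 hx) x⟩

theorem exists_norm_eq_one_inner_eq_zero_smul_norm_eq (hE : 1 < Module.rank ℝ E) {u w : E}
    (hw : ⟪u, w⟫ = 0) : ∃ e : E, ‖e‖ = 1 ∧ ⟪u, e⟫ = 0 ∧ ‖w‖ • e = w := by
  have : Nontrivial (ℝ ∙ u)ᗮ := by
    rw [Submodule.nontrivial_iff_ne_bot, Ne, Submodule.orthogonal_eq_bot_iff]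
    intro h
    have hle : Module.rank ℝ (ℝ ∙ u) ≤ 1 := by simpa using rank_span_le (R := ℝ) {u}
    rw [h, rank_top] at hle
    exact hE.not_ge hle
  obtain ⟨e, he, hwe⟩ := exists_norm_eq_one_smul_norm_eq
    (⟨w, Submodule.mem_orthogonal_singleton_iff_inner_right.2 hw⟩ : (ℝ ∙ u)ᗮ)
  exact ⟨e, he, Submodule.mem_orthogonal_singleton_iff_inner_right.1 e.2,
    congrArg Subtype.val hwe⟩

/-- The point at angle `θ` from `u` on the great circle through `u` in the direction `e`, where `u`
and `e` are meant to be orthonormal. -/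
noncomputable def greatCircle (u e : E) (θ : ℝ) : E := Real.cos θ • u + Real.sin θ • e

variable {u v e : E}

theorem norm_smul_add_smul_sq (hu : ‖u‖ = 1) (he : ‖e‖ = 1) (hue : ⟪u, e⟫ = 0) (a b : ℝ) :
    ‖a • u + b • e‖ ^ 2 = a ^ 2 + b ^ 2 := by
  rw [norm_add_sq_real, norm_smul, norm_smul, real_inner_smul_left, real_inner_smul_right, hu, he,
    hue, Real.norm_eq_abs, Real.norm_eq_abs, mul_one, mul_one, sq_abs, sq_abs]
  ring

theorem norm_greatCircle (hu : ‖u‖ = 1) (he : ‖e‖ = 1) (hue : ⟪u, e⟫ = 0) (θ : ℝ) :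
    ‖greatCircle u e θ‖ = 1 := by
  rw [← pow_eq_one_iff_of_nonneg (norm_nonneg _) two_ne_zero, greatCircle,
    norm_smul_add_smul_sq hu he hue, Real.cos_sq_add_sin_sq]

theorem lipschitzWith_greatCircle (hu : ‖u‖ = 1) (he : ‖e‖ = 1) (hue : ⟪u, e⟫ = 0) :
    LipschitzWith 1 (greatCircle u e) := by
  have hderiv (θ : ℝ) :
      HasDerivAt (greatCircle u e) (-Real.sin θ • u + Real.cos θ • e) θ :=
    ((Real.hasDerivAt_cos θ).smul_const u).add ((Real.hasDerivAt_sin θ).smul_const e)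
  refine lipschitzWith_of_nnnorm_deriv_le (𝕜 := ℝ) (fun θ => (hderiv θ).differentiableAt)
    fun θ => ?_
  rw [(hderiv θ).deriv, ← NNReal.coe_le_coe, coe_nnnorm, NNReal.coe_one,
    ← sq_le_one_iff₀ (norm_nonneg _), norm_smul_add_smul_sq hu he hue, neg_sq,
    Real.sin_sq_add_cos_sq]

theorem exists_greatCircle_angle_eq (hE : 1 < Module.rank ℝ E) (hu : ‖u‖ = 1) (hv : ‖v‖ = 1) :
    ∃ e : E, ‖e‖ = 1 ∧ ⟪u, e⟫ = 0 ∧ greatCircle u e (InnerProductGeometry.angle u v) = v := by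
  set α := InnerProductGeometry.angle u v
  have hcos : ⟪u, v⟫ = Real.cos α := InnerProductGeometry.inner_eq_cos_angle_of_norm_eq_one hu hv
  have horth : ⟪u, v - Real.cos α • u⟫ = 0 := by
    rw [inner_sub_right, real_inner_smul_right, real_inner_self_eq_norm_sq, hu, hcos]
    ring
  obtain ⟨e, he, hue, hwe⟩ := exists_norm_eq_one_inner_eq_zero_smul_norm_eq hE horth
  have hv_eq : Real.cos α • u + ‖v - Real.cos α • u‖ • e = v := by rw [hwe, add_sub_cancel]
  have hsq : ‖v - Real.cos α • u‖ ^ 2 = Real.sin α ^ 2 := by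
    have h := norm_smul_add_smul_sq hu he hue (Real.cos α) ‖v - Real.cos α • u‖
    rw [hv_eq, hv] at h
    linarith [Real.sin_sq_add_cos_sq α]
  refine ⟨e, he, hue, ?_⟩
  rwa [greatCircle, ← (sq_eq_sq₀ (norm_nonneg _)
    (InnerProductGeometry.sin_angle_nonneg u v)).1 hsq]

theorem angle_le_two_mul_norm_sub (hu : ‖u‖ = 1) (hv : ‖v‖ = 1) :
    InnerProductGeometry.angle u v ≤ 2 * ‖u - v‖ := by
  set α := InnerProductGeometry.angle u v
  have hα : 0 ≤ α := InnerProductGeometry.angle_nonneg u v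
  have hcos : Real.cos α ≤ 1 - 2 / Real.pi ^ 2 * α ^ 2 :=
    Real.cos_le_one_sub_mul_cos_sq (by
      rw [abs_of_nonneg hα]
      exact InnerProductGeometry.angle_le_pi u v)
  have hchord : ‖u - v‖ ^ 2 = 2 - 2 * Real.cos α := by
    rw [norm_sub_sq_real, InnerProductGeometry.inner_eq_cos_angle_of_norm_eq_one hu hv, hu, hv]
    ring
  have hpi : (1 : ℝ) / 8 ≤ 2 / Real.pi ^ 2 := by
    rw [div_le_div_iff₀ (by norm_num) (by positivity)]
    nlinarith [Real.pi_lt_four, Real.pi_pos]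
  refine (sq_le_sq₀ hα (by positivity)).1 ?_
  rw [mul_pow, hchord]
  nlinarith [mul_le_mul_of_nonneg_right hpi (sq_nonneg α)]

theorem mul_norm_sub_le_two_mul_norm_smul_sub_smul {F : Type*} [SeminormedAddCommGroup F]
    [NormedSpace ℝ F] {u v : F} (hu : ‖u‖ = 1) (hv : ‖v‖ = 1) {r s : ℝ} (hr : 0 ≤ r)
    (hs : 0 ≤ s) : r * ‖u - v‖ ≤ 2 * ‖r • u - s • v‖ := by
  have hnorm : ‖(s - r) • v‖ ≤ ‖r • u - s • v‖ := by
    have h := abs_norm_sub_norm_le (r • u) (s • v)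
    rwa [norm_smul, norm_smul, hu, hv, Real.norm_of_nonneg hr, Real.norm_of_nonneg hs, mul_one,
      mul_one, abs_sub_comm, ← Real.norm_eq_abs, ← mul_one ‖s - r‖, ← hv, ← norm_smul] at h
  calc r * ‖u - v‖ = ‖(r • u - s • v) + (s - r) • v‖ := by
        rw [← Real.norm_of_nonneg hr, ← norm_smul, Real.norm_of_nonneg hr]
        congr 1
        module
    _ ≤ ‖r • u - s • v‖ + ‖(s - r) • v‖ := norm_add_le _ _
    _ ≤ 2 * ‖r • u - s • v‖ := by linarith

theorem max_mul_angle_le_four_mul_norm_smul_sub_smul (hu : ‖u‖ = 1) (hv : ‖v‖ = 1) {r s : ℝ}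
    (hr : 0 ≤ r) (hs : 0 ≤ s) :
    max r s * InnerProductGeometry.angle u v ≤ 4 * ‖r • u - s • v‖ := by
  have key {u v : E} (hu : ‖u‖ = 1) (hv : ‖v‖ = 1) {r s : ℝ} (hr : 0 ≤ r) (hs : 0 ≤ s) :
      r * InnerProductGeometry.angle u v ≤ 4 * ‖r • u - s • v‖ := by
    calc r * InnerProductGeometry.angle u v ≤ r * (2 * ‖u - v‖) := by
          gcongr
          exact angle_le_two_mul_norm_sub hu hv
      _ = 2 * (r * ‖u - v‖) := by ring
      _ ≤ 2 * (2 * ‖r • u - s • v‖) := by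
          gcongr 2 * ?_
          exact mul_norm_sub_le_two_mul_norm_smul_sub_smul hu hv hr hs
      _ = 4 * ‖r • u - s • v‖ := by ring
  rw [max_mul_of_nonneg r s (InnerProductGeometry.angle_nonneg u v)]
  refine max_le (key hu hv hr hs) ?_
  rw [InnerProductGeometry.angle_comm, norm_sub_rev]
  exact key hv hu hs hr

theorem max_add_mul_angle_le_five_mul (hu : ‖u‖ = 1) (hv : ‖v‖ = 1) {r s d : ℝ} (hr : 0 ≤ r)
    (hs : 0 ≤ s) (hd : ‖r • u - s • v‖ ≤ d) :
    (max r s + d / 4) * InnerProductGeometry.angle u v ≤ 5 * d := by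
  have hd0 : 0 ≤ d := (norm_nonneg _).trans hd
  have hπ : InnerProductGeometry.angle u v ≤ 4 :=
    (InnerProductGeometry.angle_le_pi u v).trans Real.pi_le_four
  have hmax := max_mul_angle_le_four_mul_norm_smul_sub_smul hu hv hr hs
  linarith [mul_le_mul_of_nonneg_left hπ hd0]

/-- Interpolates the directions along a great circle and the norms along a parabola. -/
theorem exists_lipschitzOnWith_norm_eq_raisedLerp (hE : 1 < Module.rank ℝ E) (x y : E) {d : ℝ≥0}
    (hd : nndist x y ≤ d) : ∃ ζ : ℝ → E, ζ 0 = x ∧ ζ 1 = y ∧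
      LipschitzOnWith (7 * d) ζ unitInterval ∧
      ∀ t ∈ unitInterval, ‖ζ t‖ = raisedLerp ‖x‖ ‖y‖ d t := by
  have : Nontrivial E := (rank_pos_iff_nontrivial (R := ℝ)).1 (zero_lt_one.trans hE)
  obtain ⟨u, hu, hx⟩ := exists_norm_eq_one_smul_norm_eq x
  obtain ⟨v, hv, hy⟩ := exists_norm_eq_one_smul_norm_eq y
  obtain ⟨e, he, hue, hve⟩ := exists_greatCircle_angle_eq hE hu hv
  set α : ℝ≥0 := ⟨InnerProductGeometry.angle u v, InnerProductGeometry.angle_nonneg u v⟩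
  have hr {t : ℝ} (ht : t ∈ unitInterval) :=
    raisedLerp_mem_Icc (d := d) (norm_nonneg x) (norm_nonneg y) ht
  have hradius : LipschitzOnWith (2 * d) (raisedLerp ‖x‖ ‖y‖ d) unitInterval :=
    lipschitzOnWith_raisedLerp ((lipschitzWith_one_norm.nndist_le x y).trans (by simpa using hd))
  have hdirection : LipschitzWith α fun t : ℝ => greatCircle u e (α * t) := by
    have h := (lipschitzWith_greatCircle hu he hue).comp (lipschitzWith_smul (α : ℝ))
    rwa [one_mul, NNReal.nnnorm_eq] at h
  have hspeed : (max ‖x‖₊ ‖y‖₊ + d / 4) * α ≤ 5 * d := by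
    rw [← NNReal.coe_le_coe]
    push_cast
    refine max_add_mul_angle_le_five_mul hu hv (norm_nonneg x) (norm_nonneg y) ?_
    rwa [hx, hy, ← dist_eq_norm, ← coe_nndist, NNReal.coe_le_coe]
  refine ⟨fun t => raisedLerp ‖x‖ ‖y‖ d t • greatCircle u e (α * t), ?_, ?_, ?_, fun t ht => ?_⟩
  · simpa [greatCircle] using hx
  · change raisedLerp ‖x‖ ‖y‖ d 1 • greatCircle u e (α * 1) = y
    rw [raisedLerp_one, mul_one]
    exact hve.symm ▸ hy
  · refine (lipschitzOnWith_smul hradius hdirection.lipschitzOnWith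
      (M := max ‖x‖₊ ‖y‖₊ + d / 4) (N := 1) (fun t ht => ?_) fun t _ => ?_).weaken ?_
    · rw [abs_of_nonneg (hr ht).1]
      exact_mod_cast (hr ht).2
    · exact (norm_greatCircle hu he hue _).le
    · calc 2 * d * 1 + (max ‖x‖₊ ‖y‖₊ + d / 4) * α ≤ 2 * d * 1 + 5 * d := by gcongr
        _ = 7 * d := by ring
  · rw [norm_smul, norm_greatCircle hu he hue, mul_one, Real.norm_of_nonneg (hr ht).1]

end GreatCircle

/-! ### The quadratic spike is avoidable in dimension at least three -/

section SnocEuc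

variable {m : ℕ}

/-- The point `(x', y)` of `ℝ^m × ℝ = ℝ^{m+1}`. -/
def snocEuc (x : Euc m) (y : ℝ) : Euc (m + 1) :=
  WithLp.toLp 2 (Fin.snoc (α := fun _ => ℝ) (fun i => x i) y)

@[simp] theorem snocEuc_castSucc (x : Euc m) (y : ℝ) (i : Fin m) :
    snocEuc x y i.castSucc = x i := by
  simp [snocEuc]

@[simp] theorem snocEuc_last (x : Euc m) (y : ℝ) : snocEuc x y (Fin.last m) = y := by
  simp [snocEuc]

@[simp] theorem horizontal_apply (x : Euc (m + 1)) (i : Fin m) : horizontal x i = x i.castSucc :=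
  rfl

@[simp] theorem horizontal_snocEuc (x : Euc m) (y : ℝ) : horizontal (snocEuc x y) = x := by
  ext i
  simp

@[simp] theorem snocEuc_horizontal (x : Euc (m + 1)) :
    snocEuc (horizontal x) (x (Fin.last m)) = x := by
  ext i
  refine Fin.lastCases ?_ (fun j => ?_) i <;> simp

theorem horizontal_sub (x y : Euc (m + 1)) : horizontal (x - y) = horizontal x - horizontal y :=
  rfl

theorem norm_sq_eq_norm_horizontal_sq_add (x : Euc (m + 1)) :
    ‖x‖ ^ 2 = ‖horizontal x‖ ^ 2 + |x (Fin.last m)| ^ 2 := by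
  simp [EuclideanSpace.real_norm_sq_eq, Fin.sum_univ_castSucc]

theorem norm_le_norm_horizontal_add (x : Euc (m + 1)) :
    ‖x‖ ≤ ‖horizontal x‖ + |x (Fin.last m)| := by
  refine (sq_le_sq₀ (norm_nonneg _) (by positivity)).1 ?_
  rw [norm_sq_eq_norm_horizontal_sq_add, add_sq]
  linarith [mul_nonneg (norm_nonneg (horizontal x)) (abs_nonneg (x (Fin.last m)))]

theorem norm_horizontal_le (x : Euc (m + 1)) : ‖horizontal x‖ ≤ ‖x‖ := by
  refine (sq_le_sq₀ (norm_nonneg _) (norm_nonneg _)).1 ?_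
  rw [norm_sq_eq_norm_horizontal_sq_add]
  exact le_add_of_nonneg_right (sq_nonneg _)

theorem lipschitzWith_horizontal : LipschitzWith 1 (horizontal (m := m)) :=
  LipschitzWith.of_dist_le_mul fun x y => by
    simpa [dist_eq_norm, horizontal_sub] using norm_horizontal_le (x - y)

theorem lipschitzOnWith_snocEuc {X : Type*} [PseudoMetricSpace X] {f : X → Euc m} {g : X → ℝ}
    {s : Set X} {K L : ℝ≥0} (hf : LipschitzOnWith K f s) (hg : LipschitzOnWith L g s) :
    LipschitzOnWith (K + L) (fun x => snocEuc (f x) (g x)) s := by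
  refine LipschitzOnWith.of_dist_le_mul fun x hx y hy => ?_
  calc dist (snocEuc (f x) (g x)) (snocEuc (f y) (g y)) ≤ dist (f x) (f y) + dist (g x) (g y) := by
        simpa [dist_eq_norm, horizontal_sub] using
          norm_le_norm_horizontal_add (snocEuc (f x) (g x) - snocEuc (f y) (g y))
    _ ≤ K * dist x y + L * dist x y :=
        add_le_add (hf.dist_le_mul x hx y hy) (hg.dist_le_mul x hx y hy)
    _ = (K + L : ℝ≥0) * dist x y := by
        push_cast
        ring

end SnocEuc

section QuadraticSpike

theorem convexOn_posPart_sq : ConvexOn ℝ univ fun s : ℝ => s⁺ ^ 2 :=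
  ((convexOn_id convex_univ).sup (convexOn_const 0 convex_univ)).pow
    (fun s _ => posPart_nonneg s) 2

theorem posPart_sq_le_add_two_mul {a b : ℝ} (ha : a ≤ 1) (hb : b ≤ 1) :
    a⁺ ^ 2 ≤ b⁺ ^ 2 + 2 * |a - b| := by
  have hdiff : a⁺ - b⁺ ≤ |a - b| :=
    (le_abs_self _).trans (abs_sup_sub_sup_le_abs a b 0)
  have hsum : a⁺ + b⁺ ≤ 2 := by
    linarith [sup_le ha zero_le_one, sup_le hb zero_le_one, posPart_def a, posPart_def b]
  have hprod : (a⁺ - b⁺) * (a⁺ + b⁺) ≤ |a - b| * 2 :=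
    mul_le_mul hdiff hsum (add_nonneg (posPart_nonneg a) (posPart_nonneg b)) (abs_nonneg _)
  linarith

variable {m : ℕ}

theorem posPart_sq_le_of_mem_inwardCusp {x : Euc (m + 1)} (hx : x ∈ inwardCusp m (1 / 2)) :
    (x (Fin.last m))⁺ ^ 2 ≤ ‖horizontal x‖ := by
  have h := hx.2
  rw [cuspProfile_of_nonneg (by norm_num) (norm_nonneg _), ← Real.sqrt_eq_rpow] at h
  exact (Real.le_sqrt (posPart_nonneg _) (norm_nonneg _)).1 (sup_le h.le (Real.sqrt_nonneg _))

theorem mem_inwardCusp_of_posPart_sq_lt {x : Euc (m + 1)} (hx : ∀ i, |x i| < 1)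
    (h : (x (Fin.last m))⁺ ^ 2 < ‖horizontal x‖) : x ∈ inwardCusp m (1 / 2) := by
  refine ⟨fun i => abs_lt.1 (hx i), ?_⟩
  rw [cuspProfile_of_nonneg (by norm_num) (norm_nonneg _), ← Real.sqrt_eq_rpow]
  exact (le_posPart _).trans_lt ((Real.lt_sqrt (posPart_nonneg _)).2 h)

theorem ball_subset_inwardCusp {x : Euc (m + 1)} {t : ℝ} (ht : 0 ≤ t) (hx : ∀ i, |x i| ≤ 1 - t)
    (h : (x (Fin.last m))⁺ ^ 2 + t ≤ ‖horizontal x‖) :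
    ball x (t / 3) ⊆ inwardCusp m (1 / 2) := by
  intro z hz
  rw [mem_ball, dist_eq_norm] at hz
  have hcoord (i) : |z i - x i| ≤ ‖z - x‖ := PiLp.norm_apply_le (z - x) i
  have hz1 (i) : |z i| < 1 := by
    linarith [hx i, hcoord i, abs_sub_abs_le_abs_sub (z i) (x i)]
  have hhor : ‖horizontal x‖ ≤ ‖horizontal z‖ + ‖z - x‖ := by
    have hsub := norm_horizontal_le (z - x)
    rw [horizontal_sub] at hsub
    linarith [norm_le_norm_add_norm_sub (horizontal z) (horizontal x)]
  have hspike := posPart_sq_le_add_two_mul (abs_le.1 (hz1 (Fin.last m)).le).2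
    ((abs_le.1 (hx (Fin.last m))).2.trans (sub_le_self 1 ht))
  exact mem_inwardCusp_of_posPart_sq_lt hz1 (by linarith [hcoord (Fin.last m)])

theorem ball_smul_subset_inwardCusp {z : Euc (m + 1)} {q : ℝ} (hq : 0 ≤ q) (hq' : 19 * q ≤ 1 / 2)
    (hz : ∀ i, |z i| ≤ 1 + 18 * q) (h : (z (Fin.last m))⁺ ^ 2 + q ≤ ‖horizontal z‖) :
    ball ((1 - 19 * q) • z) (q / 6) ⊆ inwardCusp m (1 / 2) := by
  have hk : 0 ≤ 1 - 19 * q := by linarith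
  rw [show q / 6 = q / 2 / 3 by ring]
  refine ball_subset_inwardCusp (by linarith) (fun i => ?_) ?_
  · calc |((1 - 19 * q) • z) i| = (1 - 19 * q) * |z i| := by
          rw [PiLp.smul_apply, smul_eq_mul, abs_mul, abs_of_nonneg hk]
      _ ≤ (1 - 19 * q) * (1 + 18 * q) := by
          gcongr
          exact hz i
      _ ≤ 1 - q / 2 := by linarith [mul_nonneg hq hq]
  · have hpos : (((1 - 19 * q) • z) (Fin.last m))⁺ = (1 - 19 * q) * (z (Fin.last m))⁺ := by
      rw [PiLp.smul_apply, smul_eq_mul, posPart_def, posPart_def, mul_max_of_nonneg _ _ hk,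
        mul_zero]
    rw [hpos, horizontal_smul, norm_smul, Real.norm_of_nonneg hk]
    calc ((1 - 19 * q) * (z (Fin.last m))⁺) ^ 2 + q / 2
        ≤ (1 - 19 * q) * (z (Fin.last m))⁺ ^ 2 + (1 - 19 * q) * q := by
          rw [mul_pow]
          gcongr
          · exact pow_le_of_le_one hk (by linarith) two_ne_zero
          · linarith [mul_nonneg hq (sub_nonneg.2 hq')]
      _ ≤ (1 - 19 * q) * ‖horizontal z‖ := by
          rw [← mul_add]
          gcongr

theorem exists_lipschitzOnWith_avoiding_spike (hm : 2 ≤ m) {a b : Euc (m + 1)}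
    (ha : (a (Fin.last m))⁺ ^ 2 ≤ ‖horizontal a‖) (hb : (b (Fin.last m))⁺ ^ 2 ≤ ‖horizontal b‖) :
    ∃ z : ℝ → Euc (m + 1), z 0 = a ∧ z 1 = b ∧
      LipschitzOnWith (8 * nndist a b) z unitInterval ∧
      ∀ t ∈ unitInterval,
        (z t (Fin.last m))⁺ ^ 2 + dist a b * (t * (1 - t)) ≤ ‖horizontal (z t)‖ := by
  have hrank : 1 < Module.rank ℝ (Euc m) :=
    Module.one_lt_rank_of_one_lt_finrank (by rw [finrank_euclideanSpace_fin]; exact hm)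
  obtain ⟨ζ, hζ0, hζ1, hζ, hnorm⟩ := exists_lipschitzOnWith_norm_eq_raisedLerp hrank
    (horizontal a) (horizontal b) (by simpa using lipschitzWith_horizontal.nndist_le a b)
  set p := a (Fin.last m)
  set q := b (Fin.last m)
  have hpq : nndist p q ≤ nndist a b := PiLp.norm_apply_le (a - b) (Fin.last m)
  refine ⟨fun t => snocEuc (ζ t) (AffineMap.lineMap p q t), ?_, ?_, ?_, fun t ht => ?_⟩
  · simp [hζ0, p]
  · simp [hζ1, q]
  · exact (lipschitzOnWith_snocEuc hζ
      ((lipschitzWith_lineMap p q).weaken hpq).lipschitzOnWith).weaken (le_of_eq (by ring))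
  · simp only [horizontal_snocEuc, snocEuc_last]
    rw [hnorm t ht, raisedLerp, coe_nndist]
    gcongr
    calc (AffineMap.lineMap p q t : ℝ)⁺ ^ 2 ≤ (1 - t) * p⁺ ^ 2 + t * q⁺ ^ 2 := by
          rw [AffineMap.lineMap_apply_ring]
          exact convexOn_posPart_sq.2 (mem_univ p) (mem_univ q) (sub_nonneg.2 ht.2) ht.1 (by ring)
      _ ≤ AffineMap.lineMap ‖horizontal a‖ ‖horizontal b‖ t := by
          rw [AffineMap.lineMap_apply_ring]
          have := ht.1
          have := sub_nonneg.2 ht.2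
          gcongr

theorem norm_sub_lineMap_le_of_lipschitzOnWith {E : Type*} [NormedAddCommGroup E]
    [NormedSpace ℝ E] {z : ℝ → E} {K : ℝ≥0} (hz : LipschitzOnWith K z unitInterval) {t : ℝ}
    (ht : t ∈ unitInterval) :
    ‖z t - AffineMap.lineMap (z 0) (z 1) t‖ ≤
      2 * (K + nndist (z 0) (z 1) : ℝ≥0) * (t * (1 - t)) :=
  norm_le_of_lipschitzOnWith_of_eq_zero
    (hz.sub (lipschitzWith_lineMap (z 0) (z 1)).lipschitzOnWith) (by simp) (by simp) ht

theorem norm_le_add_norm_sub_lineMap {E : Type*} [SeminormedAddCommGroup E] [NormedSpace ℝ E]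
    {x y : E} {r : ℝ} (hx : ‖x‖ ≤ r) (hy : ‖y‖ ≤ r) {t : ℝ} (ht : t ∈ unitInterval) (z : E) :
    ‖z‖ ≤ r + ‖z - AffineMap.lineMap x y t‖ := by
  have h := (convex_closedBall (0 : E) r).lineMap_mem (mem_closedBall_zero_iff.2 hx)
    (mem_closedBall_zero_iff.2 hy) ht
  linarith [mem_closedBall_zero_iff.1 h, norm_le_norm_add_norm_sub (AffineMap.lineMap x y t) z,
    norm_sub_rev z (AffineMap.lineMap x y t)]

theorem exists_lipschitzOnWith_ball_subset_inwardCusp (hm : 2 ≤ m) {R : ℝ≥0}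
    (hR : ∀ x ∈ inwardCusp m (1 / 2), ‖x‖ ≤ R) {a b : Euc (m + 1)}
    (ha : a ∈ inwardCusp m (1 / 2)) (hb : b ∈ inwardCusp m (1 / 2)) (hd : dist a b < 1 / 10) :
    ∃ c : ℝ → Euc (m + 1), c 0 = a ∧ c 1 = b ∧
      LipschitzOnWith ((19 * (R + 1) + 8) * nndist a b) c unitInterval ∧
      ∀ t ∈ Ioo (0 : ℝ) 1,
        ball (c t) (1 / 6 * dist a b * (t * (1 - t))) ⊆ inwardCusp m (1 / 2) := by
  obtain ⟨z, rfl, rfl, hz, hspike⟩ := exists_lipschitzOnWith_avoiding_spike hm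
    (posPart_sq_le_of_mem_inwardCusp ha) (posPart_sq_le_of_mem_inwardCusp hb)
  set d := dist (z 0) (z 1)
  have hq {t : ℝ} (ht : t ∈ unitInterval) : 0 ≤ d * (t * (1 - t)) ∧ d * (t * (1 - t)) ≤ 1 / 40 := by
    obtain ⟨h0, h1⟩ := mul_one_sub_mem_Icc ht
    exact ⟨mul_nonneg dist_nonneg h0, by nlinarith⟩
  have hchord {t : ℝ} (ht : t ∈ unitInterval) :
      ‖z t - AffineMap.lineMap (z 0) (z 1) t‖ ≤ 18 * (d * (t * (1 - t))) := by
    refine (norm_sub_lineMap_le_of_lipschitzOnWith hz ht).trans_eq ?_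
    push_cast
    ring
  have hcoord {t : ℝ} (ht : t ∈ unitInterval) (i) : |z t i| ≤ 1 + 18 * (d * (t * (1 - t))) := by
    have hi := (PiLp.norm_apply_le (z t - AffineMap.lineMap (z 0) (z 1) t) i).trans (hchord ht)
    have h := norm_le_add_norm_sub_lineMap (abs_lt.2 (ha.1 i)).le (abs_lt.2 (hb.1 i)).le ht (z t i)
    exact h.trans (add_le_add_right hi 1)
  have hbound {t : ℝ} (ht : t ∈ unitInterval) : ‖z t‖ ≤ (R + 1 : ℝ≥0) := by
    push_cast
    linarith [norm_le_add_norm_sub_lineMap (hR _ ha) (hR _ hb) ht (z t), hchord ht, hq ht]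
  refine ⟨fun t => (1 - 19 * (d * (t * (1 - t)))) • z t, by simp, by simp, ?_, fun t ht => ?_⟩
  · have hscale : LipschitzOnWith (19 * nndist (z 0) (z 1))
        (fun t : ℝ => 1 - 19 * (d * (t * (1 - t)))) unitInterval := by
      simpa [d, mul_assoc] using (LipschitzWith.const (1 : ℝ)).lipschitzOnWith.sub
        (lipschitzOnWith_mul_mul_one_sub (19 * nndist (z 0) (z 1)))
    have habs (t) (ht : t ∈ unitInterval) : |1 - 19 * (d * (t * (1 - t)))| ≤ (1 : ℝ≥0) := by
      rw [NNReal.coe_one]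
      exact abs_le.2 ⟨by linarith [hq ht], by linarith [hq ht]⟩
    exact (lipschitzOnWith_smul hscale hz habs fun t => hbound).weaken (le_of_eq (by ring))
  · have ht' := Ioo_subset_Icc_self ht
    convert ball_smul_subset_inwardCusp (hq ht').1 (by linarith [hq ht']) (hcoord ht')
      (hspike t ht') using 2
    ring

theorem isEpsDeltaDomain_inwardCusp (hm : 2 ≤ m) :
    ∃ (ε : ℝ) (δ : ℝ≥0∞), IsEpsDeltaDomain ε δ (inwardCusp m (1 / 2)) := by
  obtain ⟨R, hR0, hR⟩ := (isBounded_inwardCusp (m := m) (γ := 1 / 2)).exists_pos_norm_le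
  lift R to ℝ≥0 using hR0.le
  refine ⟨_, _, isEpsDeltaDomain_of_lipschitzOnWith (isOpen_inwardCusp (by norm_num))
    (L := 19 * (R + 1) + 8) (κ := 1 / 6) (δ := 1 / 10) ?_ (by norm_num) (by norm_num)
    (by norm_num) fun x hx y hy _ hd =>
      exists_lipschitzOnWith_ball_subset_inwardCusp hm hR hx hy hd⟩
  exact le_add_left (by norm_num)

end QuadraticSpike

/-! ### Inward cusps are homeomorphic to balls -/

section Homeomorphism

variable {m : ℕ}

theorem continuous_snocEuc : Continuous fun z : Euc m × ℝ => snocEuc z.1 z.2 :=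
  (PiLp.continuous_toLp 2 _).comp (Continuous.finSnoc (by fun_prop) continuous_snd)

theorem exists_homeomorph_vertical_affine {a b : Euc m → ℝ} (ha : Continuous a)
    (hb : Continuous b) (ha0 : ∀ x, a x ≠ 0) :
    ∃ h : Euc (m + 1) ≃ₜ Euc (m + 1), ∀ x, h x =
      snocEuc (horizontal x) (a (horizontal x) * x (Fin.last m) + b (horizontal x)) := by
  have hhor := continuous_horizontal (m := m)
  have hlast : Continuous fun x : Euc (m + 1) => x (Fin.last m) := by fun_prop
  exact ⟨{
    toFun x := snocEuc (horizontal x) (a (horizontal x) * x (Fin.last m) + b (horizontal x))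
    invFun x := snocEuc (horizontal x) ((x (Fin.last m) - b (horizontal x)) / a (horizontal x))
    left_inv x := by simp [ha0]
    right_inv x := by simp [mul_div_cancel₀, ha0]
    continuous_toFun := continuous_snocEuc.comp <| hhor.prodMk <|
      ((ha.comp hhor).mul hlast).add (hb.comp hhor)
    continuous_invFun := continuous_snocEuc.comp <| hhor.prodMk <|
      (hlast.sub (hb.comp hhor)).div (ha.comp hhor) fun x => ha0 _ }, fun _ => rfl⟩

theorem nonempty_forall_mem_Ioo_homeomorph_subgraph {f : Euc m → ℝ} (hf : Continuous f)
    (hf1 : ∀ x, -1 < f x) :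
    Nonempty ({x : Euc (m + 1) | ∀ i, x i ∈ Ioo (-1 : ℝ) 1} ≃ₜ
      {x : Euc (m + 1) | (∀ i, horizontal x i ∈ Ioo (-1 : ℝ) 1) ∧
        x (Fin.last m) ∈ Ioo (-1) (f (horizontal x))}) := by
  have hpos (x) : 0 < (f x + 1) / 2 := by linarith [hf1 x]
  obtain ⟨h, hh⟩ := exists_homeomorph_vertical_affine (a := fun x => (f x + 1) / 2)
    (b := fun x => (f x - 1) / 2) (by fun_prop) (by fun_prop) fun x => (hpos x).ne'
  refine ⟨h.sets (Set.ext fun x => ?_)⟩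
  have hx := hpos (horizontal x)
  simp only [mem_ofPred_eq, mem_preimage, hh, horizontal_snocEuc, snocEuc_last,
    mem_Ioo, Fin.forall_fin_succ', snocEuc_castSucc, horizontal_apply]
  refine and_congr_right fun _ => and_congr ?_ ?_
  · rw [← mul_lt_mul_iff_right₀ hx]
    constructor <;> intro <;> linarith
  · rw [← mul_lt_mul_iff_right₀ hx]
    constructor <;> intro <;> linarith

theorem nonempty_homeomorph_unitBall {E : Type*} [NormedAddCommGroup E] [NormedSpace ℝ E]
    {s : Set E} (hs : Convex ℝ s) (ho : IsOpen s) (hne : s.Nonempty)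
    (hb : Bornology.IsBounded s) : Nonempty (s ≃ₜ ball (0 : E) 1) := by
  rw [← ho.interior_eq] at hne
  obtain ⟨h, hball, -⟩ := exists_homeomorph_image_interior_closure_frontier_eq_unitBall hs hne hb
  rw [ho.interior_eq] at hball
  exact ⟨(h.image s).trans (Homeomorph.setCongr hball)⟩

theorem convex_forall_mem_Ioo (n : ℕ) : Convex ℝ {x : Euc n | ∀ i, x i ∈ Ioo (-1 : ℝ) 1} := by
  rw [ofPred_forall]
  exact convex_iInter fun i =>
    (convex_Ioo (-1 : ℝ) 1).linear_preimage (EuclideanSpace.proj i).toLinearMap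

theorem inwardCusp_eq_subgraph {γ : ℝ} :
    inwardCusp m γ = {x | (∀ i, horizontal x i ∈ Ioo (-1 : ℝ) 1) ∧
      x (Fin.last m) ∈ Ioo (-1) (min 1 (cuspProfile γ ‖horizontal x‖))} := by
  ext x
  simp only [inwardCusp, mem_ofPred_eq, Fin.forall_fin_succ', horizontal_apply, mem_Ioo, lt_min_iff]
  tauto

theorem nonempty_inwardCusp_homeomorph_ball {γ : ℝ} (hγ : 0 < γ) :
    Nonempty (inwardCusp m γ ≃ₜ ball (0 : Euc (m + 1)) 1) := by
  have hf1 (x : Euc m) : -1 < min 1 (cuspProfile γ ‖x‖) := by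
    rw [cuspProfile_of_nonneg hγ (norm_nonneg _)]
    exact lt_min (by norm_num) (neg_one_lt_zero.trans_le (by positivity))
  obtain ⟨e⟩ := nonempty_forall_mem_Ioo_homeomorph_subgraph
    (continuous_const.min ((continuous_cuspProfile hγ).comp continuous_norm)) hf1
  obtain ⟨e'⟩ := nonempty_homeomorph_unitBall (convex_forall_mem_Ioo (m + 1))
    (isOpen_forall_mem_Ioo _) ⟨0, fun _ => by simp⟩ (isBounded_forall_mem_Ioo _)
  exact ⟨(Homeomorph.setCongr inwardCusp_eq_subgraph).trans (e.symm.trans e')⟩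

end Homeomorphism

theorem theorem8p3_general :
    (∀ γ : ℝ, 0 < γ → γ < 1 →
      ∃ p : ℝ≥0∞, 1 ≤ p ∧ p < ⊤ ∧ HasNonextendableField p (outwardCusp 1 γ)) ∧
    (∀ m : ℕ, 2 ≤ m + 1 → ∀ γ : ℝ, 0 < γ → γ < 1 →
      ∃ p : ℝ≥0∞, 1 < p ∧ p < ⊤ ∧ HasNonextendableField p (inwardCusp m γ)) ∧
    (∀ n : ℕ, 3 ≤ n →
      ∃ (Ω : Set (Euc n)) (p : ℝ≥0∞), (∃ (ε : ℝ) (δ : ℝ≥0∞), IsEpsDeltaDomain ε δ Ω) ∧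
        Bornology.IsBounded Ω ∧ Nonempty (Ω ≃ₜ ball (0 : Euc n) 1) ∧
        1 < p ∧ p < ⊤ ∧ HasNonextendableField p Ω) := by
  refine ⟨fun γ hγ hγ1 => exists_hasNonextendableField_outwardCusp_one hγ hγ1,
    fun m hm γ hγ hγ1 => exists_hasNonextendableField_inwardCusp (by omega) hγ hγ1,
    fun n hn => ?_⟩
  obtain ⟨m, rfl⟩ := Nat.exists_eq_add_one.2 (by omega : 0 < n)
  obtain ⟨p, hp⟩ := exists_hasNonextendableField_inwardCusp (m := m) (γ := 1 / 2) (by omega)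
    (by norm_num) (by norm_num)
  exact ⟨inwardCusp m (1 / 2), p, isEpsDeltaDomain_inwardCusp (by omega), isBounded_inwardCusp,
    nonempty_inwardCusp_homeomorph_ball (by norm_num), hp⟩

theorem theorem8p3 :
    -- (a) outward cusps in the plane
    (∀ γ : ℝ, 0 < γ → γ < 1 →
      ∃ (p : ℝ≥0∞) (_ : Fact (1 ≤ p)), p < ⊤ ∧
        ∀ η : ℝ, 0 < η →
          ¬ HasSolenoidalExtension p (outwardCusp 1 γ)
              (Metric.thickening η (outwardCusp 1 γ))) ∧
    -- (b) inward cusps in dimension n = m + 1 ≥ 2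
    (∀ m : ℕ, 2 ≤ m + 1 → ∀ γ : ℝ, 0 < γ → γ < 1 →
      ∃ (p : ℝ≥0∞) (_ : Fact (1 ≤ p)), 1 < p ∧ p < ⊤ ∧
        ∀ η : ℝ, 0 < η →
          ¬ HasSolenoidalExtension p (inwardCusp m γ)
              (Metric.thickening η (inwardCusp m γ))) ∧
    -- (c) (ε, δ)-domains in dimension n ≥ 3
    (∀ n : ℕ, 3 ≤ n →
      ∃ (Ω : Set (Euc n)) (p : ℝ≥0∞) (_ : Fact (1 ≤ p)),
        (∃ (ε : ℝ) (δ : ℝ≥0∞), IsEpsDeltaDomain ε δ Ω) ∧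
        Bornology.IsBounded Ω ∧ Nonempty (Ω ≃ₜ Metric.ball (0 : Euc n) 1) ∧
        1 < p ∧ p < ⊤ ∧
        ∀ η : ℝ, 0 < η →
          ¬ HasSolenoidalExtension p Ω (Metric.thickening η Ω)) := by
  obtain ⟨ha, hb, hc⟩ := theorem8p3_general
  refine ⟨fun γ hγ hγ1 => ?_, fun m hm γ hγ hγ1 => ?_, fun n hn => ?_⟩
  · obtain ⟨p, hp, hpt, h⟩ := ha γ hγ hγ1
    have := Fact.mk hp
    exact ⟨p, this, hpt, fun η => h.not_hasSolenoidalExtension⟩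
  · obtain ⟨p, hp, hpt, h⟩ := hb m hm γ hγ hγ1
    have := Fact.mk hp.le
    exact ⟨p, this, hp, hpt, fun η => h.not_hasSolenoidalExtension⟩
  · obtain ⟨Ω, p, hεδ, hbdd, hball, hp, hpt, h⟩ := hc n hn
    have := Fact.mk hp.le
    exact ⟨Ω, p, this, hεδ, hbdd, hball, hp, hpt, fun η => h.not_hasSolenoidalExtension⟩
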